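/- **The model.** Let $n\ge 1$ be an integer and $\mu>0$. A picker alternates between two carousels, picking one item per order. Let $P_k$ (pick times, $k\ge1$) and $R_k$ (rotation times, $k\ge 1$) be two i.i.d. sequences, independent of each other, where $P_k$ has the Erlang$(\mu,n)$ distribution $G(x)=1-e^{-\mu x}\sum_{j=0}^{n-1}(\mu x)^j/j!$, $x\ge0$, and $R_k$ is uniform on $[0,1)$. The waiting times of the picker are given by $P_0=W_0=0$ and $W_{k+1}=(R_{k+1}-P_k-W_k)^+$, $k\ge0$. The $k$-th order is completed at time $T_k=\sum_{j=1}^k(W_j+P_j)$. The throughput $\tau$ is the long-run number of orders processed per unit time, $\tau=\lim_{t\to\infty}\#\{k\ge1: T_k\le t\}/t$ (almost surely). **The constants.** Let $W$ have an equilibrium distribution of the chain $(W_k)$, i.e. $W\overset{d}{=}(R-P-W)^+$ with $R,P,W$ independent on the right-hand side, $R$ uniform on $[0,1)$ and $P$ Erlang$(\mu,n)$. Put $\pi_0=\mathbb P[W=0]$, let $f$ be the density of $W$ on $(0,1]$, and let $\varphi(s)=\int_0^1e^{-sx}f(x)\,dx$ for $s\in\mathbb C$. Let $$R(s)=s^2(\mu^2-s^2)^n+\mu^{2n},$$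 $$\begin{aligned}A(s)={}&\pi_0\Bigl(\mu^n+e^{-(\mu+s)}\sum_{j=0}^{n-1}\sum_{i=0}^{j}\frac{s\mu^j(\mu+s)^{n-j-1+i}}{i!}\Bigr)-e^{-s}(\mu+s)^n\\&+e^{-(\mu+s)}\sum_{j=0}^{n-1}\sum_{i=0}^{j}\sum_{\ell=0}^{i}\binom i\ell\frac{s\mu^j(\mu+s)^{n-j-1+i}}{i!}\,\varphi^{(\ell)}(-\mu),\end{aligned}$$ and let $P(s),Q(s)$ be the polynomials obtained by collecting the terms with $e^{-s}$ in $$-e^{-s}s(\mu+s)^nA(-s)-\mu^nA(s)=P(s)+e^{-s}Q(s).$$ Let $r_1,\dots,r_{2n+2}\in\mathbb C$ be the zeros of $R$ (counted with multiplicity), and let $c_i=P(r_i)/R'(r_i)$. **Statement.** The zeros $r_i$ are simple and nonzero. The equilibrium distribution exists and is unique, it is absolutely continuous on $(0,1]$, $P$ and $W$ have finite means, the throughput $\tau$ exists, and $$\tau^{-1}=\mathbb E[P]+\mathbb E[W]=\frac n\mu+\sum_{i=1}^{2n+2}\frac{c_i}{r_i^2}\bigl[1+(r_i-1)e^{r_i}\bigr].$$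 -/

import Mathlib

open MeasureTheory ProbabilityTheory Filter Topology Polynomial
open scoped BigOperators

namespace Carousel

noncomputable section

/-- The Erlang distribution with `n` stages and rate `μ`, i.e. the Gamma distribution with shape
`n` and rate `μ`; for `n ≥ 1` its distribution function is
`1 - e^{-μ x} ∑_{j < n} (μ x)^j / j!`, `x ≥ 0`. -/
def pickLaw (n : ℕ) (μ : ℝ) : Measure ℝ := gammaMeasure (n : ℝ) μ

/-- The uniform distribution on `[0, 1)`. -/
def rotationLaw : Measure ℝ := volume.restrict (Set.Ico 0 1)

/-- `P k` and `R k` (`k ≥ 1`) are the pick time and the rotation time of the `k`-th order: two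
i.i.d. sequences, independent of each other, with Erlang and uniform marginals.
By convention `P 0 = 0`; the value of `R 0` is never used. -/
structure IsCarouselInput {Ω : Type*} [MeasurableSpace Ω] (Pr : Measure Ω) (n : ℕ) (μ : ℝ)
    (P R : ℕ → Ω → ℝ) : Prop where
  pick_zero : ∀ ω, P 0 ω = 0
  pick_law : ∀ k, 1 ≤ k → HasLaw (P k) (pickLaw n μ) Pr
  rotation_law : ∀ k, 1 ≤ k → HasLaw (R k) rotationLaw Pr
  indep : iIndepFun (Sum.elim (fun k : ℕ => P (k + 1)) (fun k : ℕ => R (k + 1))) Pr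

/-- The waiting times of the picker: `W_0 = 0` and `W_{k+1} = (R_{k+1} - P_k - W_k)^+`. -/
def waitingTime {Ω : Type*} (P R : ℕ → Ω → ℝ) : ℕ → Ω → ℝ
  | 0, _ => 0
  | k + 1, ω => max 0 (R (k + 1) ω - P k ω - waitingTime P R k ω)

/-- The epoch at which the pick of the `k`-th order is completed. The picker is always either
waiting for the next item or picking it. -/
def completionTime {Ω : Type*} (P R : ℕ → Ω → ℝ) (k : ℕ) (ω : Ω) : ℝ :=
  ∑ j ∈ Finset.Icc 1 k, (waitingTime P R j ω + P j ω)

/-- The number of orders whose processing has been completed by time `t`. -/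
def ordersProcessed {Ω : Type*} (P R : ℕ → Ω → ℝ) (t : ℝ) (ω : Ω) : ℕ :=
  Set.ncard {k : ℕ | 1 ≤ k ∧ completionTime P R k ω ≤ t}

/-- `τ` is the throughput: almost surely, the long-run number of orders processed per unit
time is `τ`. -/
def IsThroughput {Ω : Type*} [MeasurableSpace Ω] (Pr : Measure Ω) (P R : ℕ → Ω → ℝ) (τ : ℝ) :
    Prop :=
  ∀ᵐ ω ∂Pr, Tendsto (fun t : ℝ => (ordersProcessed P R t ω : ℝ) / t) atTop (𝓝 τ)

/-- `ν` is an equilibrium distribution of the waiting time: if `W ∼ ν`, and `R`, `P`, `W` are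
independent with `R` uniform and `P` Erlang, then `(R - P - W)^+ ∼ ν`. -/
def IsEquilibrium (n : ℕ) (μ : ℝ) (ν : Measure ℝ) : Prop :=
  IsProbabilityMeasure ν ∧
    ((rotationLaw.prod ((pickLaw n μ).prod ν)).map
      fun x : ℝ × ℝ × ℝ => max 0 (x.1 - x.2.1 - x.2.2)) = ν

/-- The atom `π₀ = P[W = 0]` of the waiting-time distribution `ν`. -/
def atomZero (ν : Measure ℝ) : ℝ := ν.real {0}

/-- The density `f` on `[0, 1]` of the waiting-time distribution `ν` off its atom at `0`. -/
def density (ν : Measure ℝ) (x : ℝ) : ℝ :=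
  ((ν.restrict (Set.Ioc 0 1)).rnDeriv volume x).toReal

/-- The Laplace transform `φ(s) = ∫₀¹ e^{-sx} f(x) dx` of the density. -/
def phi (ν : Measure ℝ) (s : ℂ) : ℂ :=
  ∫ x in (0 : ℝ)..1, Complex.exp (-s * x) * (density ν x : ℂ)

/-- The polynomial `R(s) = s² (μ² - s²)ⁿ + μ²ⁿ`. -/
def polyR (n : ℕ) (μ : ℝ) : ℂ[X] :=
  X ^ 2 * (C ((μ : ℂ) ^ 2) - X ^ 2) ^ n + C ((μ : ℂ) ^ (2 * n))

/-- The function `A(s)`, with `π₀` and `φ` those of the waiting-time distribution `ν`. -/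
def funA (n : ℕ) (μ : ℝ) (ν : Measure ℝ) (s : ℂ) : ℂ :=
  (atomZero ν : ℂ) * ((μ : ℂ) ^ n + Complex.exp (-(μ + s)) *
      ∑ j ∈ Finset.range n, ∑ i ∈ Finset.range (j + 1),
        s * (μ : ℂ) ^ j * (μ + s) ^ (n - j - 1 + i) / (Nat.factorial i : ℂ))
    - Complex.exp (-s) * (μ + s) ^ n
    + Complex.exp (-(μ + s)) *
      ∑ j ∈ Finset.range n, ∑ i ∈ Finset.range (j + 1), ∑ l ∈ Finset.range (i + 1),
        (Nat.choose i l : ℂ) *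
          (s * (μ : ℂ) ^ j * (μ + s) ^ (n - j - 1 + i) / (Nat.factorial i : ℂ)) *
          iteratedDeriv l (phi ν) (-μ)

/-- The polynomial `B` with `A(s) = π₀ μⁿ + e^{-s} B(s)`. -/
def polyB (n : ℕ) (μ : ℝ) (ν : Measure ℝ) : ℂ[X] :=
  C ((atomZero ν : ℂ) * Complex.exp (-μ)) *
      ∑ j ∈ Finset.range n, ∑ i ∈ Finset.range (j + 1),
        C ((μ : ℂ) ^ j / (Nat.factorial i : ℂ)) * X * (C (μ : ℂ) + X) ^ (n - j - 1 + i)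
    - (C (μ : ℂ) + X) ^ n
    + C (Complex.exp (-μ)) *
      ∑ j ∈ Finset.range n, ∑ i ∈ Finset.range (j + 1), ∑ l ∈ Finset.range (i + 1),
        C ((Nat.choose i l : ℂ) * ((μ : ℂ) ^ j / (Nat.factorial i : ℂ)) *
            iteratedDeriv l (phi ν) (-μ)) *
          X * (C (μ : ℂ) + X) ^ (n - j - 1 + i)

/-- The part free of `e^{-s}` of `-e^{-s} s (μ + s)ⁿ A(-s) - μⁿ A(s)`. -/
def polyP (n : ℕ) (μ : ℝ) (ν : Measure ℝ) : ℂ[X] :=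
  -(X * (C (μ : ℂ) + X) ^ n * (polyB n μ ν).comp (-X)) - C ((atomZero ν : ℂ) * (μ : ℂ) ^ (2 * n))

/-- The coefficient of `e^{-s}` in `-e^{-s} s (μ + s)ⁿ A(-s) - μⁿ A(s)`. -/
def polyQ (n : ℕ) (μ : ℝ) (ν : Measure ℝ) : ℂ[X] :=
  -(X * (C (μ : ℂ) + X) ^ n * C ((atomZero ν : ℂ) * (μ : ℂ) ^ n)) - C ((μ : ℂ) ^ n) * polyB n μ ν

theorem funA_eq (n : ℕ) (μ : ℝ) (ν : Measure ℝ) (s : ℂ) :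
    funA n μ ν s =
      (atomZero ν : ℂ) * (μ : ℂ) ^ n + Complex.exp (-s) * (polyB n μ ν).eval s := by
  have h : Complex.exp (-(μ + s)) = Complex.exp (-s) * Complex.exp (-μ) := by
    rw [← Complex.exp_add]; congr 1; ring
  simp only [funA, polyB, eval_add, eval_sub, eval_mul, eval_pow, eval_C, eval_X,
    eval_finsetSum, h]
  have h1 : ∀ j i : ℕ, s * (μ : ℂ) ^ j * (μ + s) ^ (n - j - 1 + i) / (Nat.factorial i : ℂ) =
      (μ : ℂ) ^ j / (Nat.factorial i : ℂ) * s * (μ + s) ^ (n - j - 1 + i) := by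
    intro j i; ring
  have h2 : ∀ j i l : ℕ, (Nat.choose i l : ℂ) *
        ((μ : ℂ) ^ j / (Nat.factorial i : ℂ) * s * (μ + s) ^ (n - j - 1 + i)) *
        iteratedDeriv l (phi ν) (-μ) =
      (Nat.choose i l : ℂ) * ((μ : ℂ) ^ j / (Nat.factorial i : ℂ)) *
        iteratedDeriv l (phi ν) (-μ) * s * (μ + s) ^ (n - j - 1 + i) := by
    intro j i l; ring
  simp only [h1, h2]
  ring

/-- `P` and `Q` arise from `-e^{-s} s (μ + s)ⁿ A(-s) - μⁿ A(s)` by collecting the terms that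
include `e^{-s}`. -/
theorem polyP_add_polyQ (n : ℕ) (μ : ℝ) (ν : Measure ℝ) (s : ℂ) :
    (polyP n μ ν).eval s + Complex.exp (-s) * (polyQ n μ ν).eval s =
      -(Complex.exp (-s) * s * (μ + s) ^ n * funA n μ ν (-s)) - (μ : ℂ) ^ n * funA n μ ν s := by
  have h : Complex.exp (-s) * Complex.exp s = 1 := by
    rw [← Complex.exp_add]; simp
  simp only [funA_eq, polyP, polyQ, eval_sub, eval_neg, eval_mul, eval_pow, eval_add, eval_C,
    eval_X, eval_comp, neg_neg]
  linear_combination (s * (μ + s) ^ n * eval (-s) (polyB n μ ν)) * h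

/-- The coefficient `c = P(r) / R'(r)` belonging to a zero `r` of `R`. -/
def coeffC (n : ℕ) (μ : ℝ) (ν : Measure ℝ) (r : ℂ) : ℂ :=
  (polyP n μ ν).eval r / (derivative (polyR n μ)).eval r

end

end Carousel

namespace Carousel

/-! The argument has an analytic half, which computes the mean of the equilibrium law, and a
probabilistic half, which shows that this mean governs the throughput.

Analytic half. The equilibrium equation, tested on `e^{-s(1-x)}` over `(0, 1]`, can be integrated
explicitly in `R`, then `P`, then `W`. The outcome, `phi_functional_equation`, is a linear relation
between `φ(s)` and `φ(-s)`. Combining it with its copy at `-s` eliminates `φ(-s)` and gives `R(s)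
φ(s) = P(s) + e^{-s} Q(s)` (`polyR_mul_phi`). Since `φ` is entire, the right side vanishes at each
zero of `R`, which expresses `Q(r_i)` through `P(r_i)`. The zeros are simple and `P`, `Q` have
degree below `2n + 2`, so partial fractions give `φ` near `0`, and `E[W] = -φ'(0)`.

Probabilistic half. On the event `R ≤ P` the next waiting time is `0`, whatever the present one.
This event has positive probability `1 - q`, because the pick time exceeds `1` with positive
probability. One step of the chain is therefore a fixed reset measure plus a linear operator that
multiplies mass by `q < 1`. A Neumann series gives existence, and a comparison of iterates gives
uniqueness and geometric convergence of means.

For the almost sure limit, the chain is compared with copies restarted from `0` at the start of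
every block of `m` steps. The copies at a fixed offset in different blocks are i.i.d., so the strong
law applies to them. The coupling error at offset `i` has mean at most `q ^ i`, so a block
contributes a bounded total error, negligible against `m`. The law of large numbers for `T_k` is
then inverted into a statement about the counting function (`tendsto_ncard_div`). -/

/-! ### Zeros of the polynomial `R`. -/

theorem polyR_eval (n : ℕ) (μ : ℝ) (s : ℂ) :
    (polyR n μ).eval s = s ^ 2 * ((μ : ℂ) ^ 2 - s ^ 2) ^ n + (μ : ℂ) ^ (2 * n) := by
  simp [polyR]

theorem polyR_eval_zero_ne {n : ℕ} {μ : ℝ} (hμ : 0 < μ) : (polyR n μ).eval 0 ≠ 0 := by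
  have : (μ : ℂ) ≠ 0 := by exact_mod_cast hμ.ne'
  simp [polyR_eval, this]

theorem polyR_ne_zero {n : ℕ} {μ : ℝ} (hμ : 0 < μ) : polyR n μ ≠ 0 := by
  intro h
  exact polyR_eval_zero_ne (n := n) hμ (by simp [h])

theorem polyR_derivative_eval (m : ℕ) (μ : ℝ) (s : ℂ) :
    (derivative (polyR (m + 1) μ)).eval s =
      2 * s * ((μ : ℂ) ^ 2 - s ^ 2) ^ m * ((μ : ℂ) ^ 2 - (m + 2) * s ^ 2) := by
  simp [polyR, derivative_pow]
  ring

/-- The critical points are explicit: `s = 0`, `s² = μ²` or `s² = μ² / (n + 1)`. In the first two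
cases `R(s) = μ^{2n}`; in the third `s²` is real and lies between `0` and `μ²`, so `R(s)` is a
nonnegative real plus `μ^{2n}`. -/
theorem polyR_simple_root {n : ℕ} (hn : 1 ≤ n) {μ : ℝ} (hμ : 0 < μ) {s : ℂ}
    (hs : (polyR n μ).eval s = 0) : (derivative (polyR n μ)).eval s ≠ 0 := by
  obtain ⟨m, rfl⟩ : ∃ m, n = m + 1 := ⟨n - 1, by omega⟩
  have hμ' : (μ : ℂ) ≠ 0 := by exact_mod_cast hμ.ne'
  intro h
  rw [polyR_derivative_eval] at h
  rw [polyR_eval] at hs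
  have hs0 : s ≠ 0 := by
    rintro rfl
    simp [hμ'] at hs
  rcases mul_eq_zero.1 h with h | h
  · rcases mul_eq_zero.1 h with h | h
    · simp [hs0] at h
    · have h' := eq_zero_of_pow_eq_zero h
      simp [h', hμ'] at hs
  · have hm : ((m : ℂ) + 2) ≠ 0 := by exact_mod_cast (by positivity : (m : ℝ) + 2 ≠ 0)
    have h2 : s ^ 2 = ((μ ^ 2 / (m + 2) : ℝ) : ℂ) := by
      push_cast
      field_simp
      linear_combination -h
    rw [h2] at hs
    have h3 : μ ^ 2 / (m + 2) * (μ ^ 2 - μ ^ 2 / (m + 2)) ^ (m + 1) + μ ^ (2 * (m + 1)) = 0 := by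
      exact_mod_cast hs
    have h4 : 0 ≤ μ ^ 2 - μ ^ 2 / (m + 2) := by
      rw [sub_nonneg]
      apply div_le_self (by positivity)
      linarith [(Nat.cast_nonneg m : (0 : ℝ) ≤ m)]
    have : 0 < μ ^ (2 * (m + 1)) := by positivity
    have : 0 ≤ μ ^ 2 / (m + 2) * (μ ^ 2 - μ ^ 2 / (m + 2)) ^ (m + 1) := by positivity
    linarith

/-! ### Partial fractions and degree bounds. -/

/-- Partial fractions for a polynomial all of whose roots are simple. -/
theorem eval_div_eval_eq_sum {N : ℕ} {F p : ℂ[X]} (hF : F ≠ 0) {r : Fin N → ℂ}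
    (hr : F.roots = Finset.univ.val.map r)
    (hsimple : ∀ i, (derivative F).eval (r i) ≠ 0) (hp : p.degree < N) {s : ℂ}
    (hs : F.eval s ≠ 0) :
    p.eval s / F.eval s = ∑ i, p.eval (r i) / (derivative F).eval (r i) / (s - r i) := by
  have hfac : F = C F.leadingCoeff * Lagrange.nodal Finset.univ r := by
    have h := (IsAlgClosed.splits F).eq_prod_roots
    rw [hr, Multiset.map_map] at h
    exact h
  set a := F.leadingCoeff with ha
  have ha0 : a ≠ 0 := leadingCoeff_ne_zero.2 hF
  have hnodup : F.roots.Nodup := by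
    rw [nodup_roots_iff_of_splits hF (IsAlgClosed.splits F)]
    -- If `F` and its derivative were not coprime, a common irreducible factor would have a root
    -- over `ℂ`, and this would be a multiple root of `F`.
    by_contra hns
    obtain ⟨x, hx1, hx2⟩ : ∃ x, F.eval x = 0 ∧ (derivative F).eval x = 0 := by
      by_contra! hcon
      apply hns
      rw [Separable]
      refine isCoprime_of_irreducible_dvd (by simp [hF]) ?_
      intro q hq hq1 hq2
      obtain ⟨x, hx⟩ := IsAlgClosed.exists_root q (degree_pos_of_irreducible hq).ne'
      exact hcon x (eval_eq_zero_of_dvd_of_eval_eq_zero hq1 hx)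
        (eval_eq_zero_of_dvd_of_eval_eq_zero hq2 hx)
    have : x ∈ F.roots := (mem_roots hF).2 hx1
    rw [hr, Multiset.mem_map] at this
    obtain ⟨i, -, rfl⟩ := this
    exact hsimple i hx2
  have hinj : Function.Injective r := by
    rw [hr] at hnodup
    intro i j hij
    exact Multiset.inj_on_of_nodup_map hnodup i (Finset.mem_univ i) j (Finset.mem_univ j) hij
  have hsr : ∀ i ∈ Finset.univ, s ≠ r i := by
    rintro i - rfl
    apply hs
    have : r i ∈ F.roots := by
      rw [hr, Multiset.mem_map]
      exact ⟨i, Finset.mem_univ i, rfl⟩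
    exact ((mem_roots hF).1 this)
  -- The degree bound makes `p` its own Lagrange interpolant at the roots. Up to the leading
  -- coefficient `F` is the nodal polynomial, so the Lagrange weights are the inverses of its
  -- derivative at the nodes.
  have hpi : p = Lagrange.interpolate Finset.univ r (fun i => p.eval (r i)) :=
    Lagrange.eq_interpolate hinj.injOn (by simpa using hp)
  have hn0 := Lagrange.eval_nodal_not_at_node (s := Finset.univ) hsr
  have hder : ∀ i, (derivative F).eval (r i) =
      a * (Lagrange.nodalWeight Finset.univ r i)⁻¹ := by
    intro i
    rw [Lagrange.nodalWeight_eq_eval_derivative_nodal (Finset.mem_univ i), inv_inv]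
    conv_lhs => rw [hfac]
    rw [derivative_C_mul, eval_mul, eval_C]
  have h1 : p.eval s = eval s (Lagrange.nodal Finset.univ r) *
      ∑ i, Lagrange.nodalWeight Finset.univ r i * (s - r i)⁻¹ * p.eval (r i) := by
    conv_lhs => rw [hpi]
    exact Lagrange.eval_interpolate_not_at_node _ hsr
  have h2 : F.eval s = a * eval s (Lagrange.nodal Finset.univ r) := by
    conv_lhs => rw [hfac]
    rw [eval_mul, eval_C]
  rw [h1, h2, mul_comm a, mul_div_mul_left _ _ hn0, Finset.sum_div]
  refine Finset.sum_congr rfl fun i _ => ?_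
  rw [hder]
  simp only [div_eq_mul_inv, mul_inv, inv_inv]
  ring

/-- In every summand `i ≤ j` keeps the exponent `n - j - 1 + i` at most `n - 1`, and the extra
factor `X` brings the degree to at most `n`. -/
theorem natDegree_polyB_le (n : ℕ) (μ : ℝ) (ν : Measure ℝ) : (polyB n μ ν).natDegree ≤ n := by
  have key : ∀ j ∈ Finset.range n, ∀ i ∈ Finset.range (j + 1), ∀ c : ℂ,
      (C c * X * (C (μ : ℂ) + X) ^ (n - j - 1 + i)).natDegree ≤ n := by
    intro j hj i hi c
    rw [Finset.mem_range] at hj hi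
    have h2 : ((C (μ : ℂ) + X) ^ (n - j - 1 + i)).natDegree ≤ n - j - 1 + i := by
      simp
    have h3 : (C c * X).natDegree ≤ 1 := (natDegree_C_mul_le _ _).trans natDegree_X_le
    exact (natDegree_mul_le_of_le h3 h2).trans (by omega)
  unfold polyB
  refine natDegree_add_le_of_degree_le ((natDegree_sub_le _ _).trans (max_le ?_ ?_)) ?_
  · refine (natDegree_C_mul_le _ _).trans ?_
    exact natDegree_sum_le_of_forall_le _ _ fun j hj =>
      natDegree_sum_le_of_forall_le _ _ fun i hi => key j hj i hi _
  · simp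
  · refine (natDegree_C_mul_le _ _).trans ?_
    exact natDegree_sum_le_of_forall_le _ _ fun j hj =>
      natDegree_sum_le_of_forall_le _ _ fun i hi =>
        natDegree_sum_le_of_forall_le _ _ fun l _ => key j hj i hi _

theorem natDegree_X_mul_C_add_X_pow_le (n : ℕ) (c : ℂ) :
    (X * (C c + X) ^ n).natDegree ≤ n + 1 := by
  have h2 : ((C c + X) ^ n).natDegree ≤ n := by simp
  exact (natDegree_mul_le_of_le natDegree_X_le h2).trans (by omega)

theorem degree_polyP_lt (n : ℕ) (μ : ℝ) (ν : Measure ℝ) :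
    (polyP n μ ν).degree < ((2 * n + 2 : ℕ) : WithBot ℕ) := by
  have h : (polyP n μ ν).natDegree ≤ 2 * n + 1 := by
    unfold polyP
    refine (natDegree_sub_le _ _).trans (max_le ?_ ((natDegree_C _).trans_le (Nat.zero_le _)))
    rw [natDegree_neg]
    have h1 : ((polyB n μ ν).comp (-X)).natDegree ≤ n := by
      simpa [natDegree_comp] using natDegree_polyB_le n μ ν
    exact (natDegree_mul_le_of_le (natDegree_X_mul_C_add_X_pow_le n μ) h1).trans (by omega)
  exact degree_le_natDegree.trans_lt (by exact_mod_cast Nat.lt_succ_of_le h)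

theorem degree_polyQ_lt (n : ℕ) (μ : ℝ) (ν : Measure ℝ) :
    (polyQ n μ ν).degree < ((2 * n + 2 : ℕ) : WithBot ℕ) := by
  have h : (polyQ n μ ν).natDegree ≤ 2 * n + 1 := by
    unfold polyQ
    refine (natDegree_sub_le _ _).trans (max_le ?_ ?_)
    · rw [natDegree_neg]
      refine (natDegree_mul_C_le _ _).trans ?_
      exact (natDegree_X_mul_C_add_X_pow_le n μ).trans (by omega)
    · exact (natDegree_C_mul_le _ _).trans ((natDegree_polyB_le n μ ν).trans (by omega))
  exact degree_le_natDegree.trans_lt (by exact_mod_cast Nat.lt_succ_of_le h)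

/-! ### The pick-time and rotation-time laws. -/

theorem isProbabilityMeasure_pickLaw {n : ℕ} (hn : 1 ≤ n) {μ : ℝ} (hμ : 0 < μ) :
    IsProbabilityMeasure (pickLaw n μ) :=
  isProbabilityMeasure_gammaMeasure (by exact_mod_cast hn) hμ

instance : IsProbabilityMeasure rotationLaw := ⟨by simp [rotationLaw]⟩

theorem gammaPDFReal_nat_succ (m : ℕ) (μ : ℝ) {x : ℝ} (hx : 0 ≤ x) :
    gammaPDFReal ((m + 1 : ℕ) : ℝ) μ x =
      μ ^ (m + 1) / (m.factorial : ℝ) * x ^ m * Real.exp (-(μ * x)) := by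
  rw [gammaPDFReal, if_pos hx, Real.rpow_natCast, Nat.cast_succ, Real.Gamma_nat_eq_factorial,
    add_sub_cancel_right, Real.rpow_natCast]

theorem measurable_gammaPDF (a r : ℝ) : Measurable (gammaPDF a r) :=
  (measurable_gammaPDFReal a r).ennreal_ofReal

theorem integral_pickLaw_eq {E : Type*} [NormedAddCommGroup E] [NormedSpace ℝ E]
    {n : ℕ} (hn : 1 ≤ n) {μ : ℝ} (hμ : 0 < μ) (g : ℝ → E) :
    ∫ p, g p ∂(pickLaw n μ) = ∫ p, gammaPDFReal n μ p • g p := by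
  have hn' : (0 : ℝ) < n := by exact_mod_cast hn
  rw [pickLaw, gammaMeasure,
    integral_withDensity_eq_integral_toReal_smul
      (measurable_gammaPDF _ _) (by simp [gammaPDF])]
  simp only [gammaPDF, ENNReal.toReal_ofReal (gammaPDFReal_nonneg hn' hμ _)]

theorem ae_pos_pickLaw (n : ℕ) (μ : ℝ) : ∀ᵐ p ∂(pickLaw n μ), 0 < p := by
  rw [ae_iff, pickLaw, gammaMeasure,
    withDensity_apply _ (by measurability)]
  have : {a : ℝ | ¬0 < a} = Set.Iic 0 := by ext; simp
  rw [this, setLIntegral_congr Iio_ae_eq_Iic.symm]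
  exact lintegral_gammaPDF_of_nonpos le_rfl

theorem pickLaw_Ici_one_ne_zero {n : ℕ} (hn : 1 ≤ n) {μ : ℝ} (hμ : 0 < μ) :
    pickLaw n μ (Set.Ici 1) ≠ 0 := by
  have hn' : (0 : ℝ) < n := by exact_mod_cast hn
  rw [pickLaw, gammaMeasure, withDensity_apply _ measurableSet_Ici]
  intro h
  rw [setLIntegral_eq_zero_iff measurableSet_Ici
    (measurable_gammaPDF _ _)] at h
  have h2 : ∀ᵐ x ∂(volume : Measure ℝ), x ∉ Set.Ici (1 : ℝ) := by
    filter_upwards [h] with x hx hx1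
    have := hx hx1
    rw [gammaPDF, ENNReal.ofReal_eq_zero] at this
    exact (gammaPDFReal_pos hn' hμ (zero_lt_one.trans_le hx1)).not_ge this
  have h3 : volume (Set.Ici (1 : ℝ)) = 0 := measure_eq_zero_iff_ae_notMem.2 h2
  simp at h3

theorem integral_id_pickLaw {n : ℕ} (hn : 1 ≤ n) {μ : ℝ} (hμ : 0 < μ) :
    ∫ p, p ∂(pickLaw n μ) = n / μ := by
  obtain ⟨m, rfl⟩ : ∃ m, n = m + 1 := ⟨n - 1, by omega⟩
  rw [integral_pickLaw_eq hn hμ]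
  have h1 : ∫ p, gammaPDFReal ((m + 1 : ℕ) : ℝ) μ p • p =
      ∫ p in Set.Ioi 0, gammaPDFReal ((m + 1 : ℕ) : ℝ) μ p • p := by
    refine (setIntegral_eq_integral_of_forall_compl_eq_zero fun x hx => ?_).symm
    rcases (not_lt.1 (Set.mem_Ioi.not.1 hx)).lt_or_eq with h | h
    · simp [gammaPDFReal, h.not_ge]
    · simp [h]
  have h2 : ∫ p in Set.Ioi 0, gammaPDFReal ((m + 1 : ℕ) : ℝ) μ p • p =
      ∫ p in Set.Ioi 0, μ ^ (m + 1) / (m.factorial : ℝ) *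
        (p ^ (((m + 2 : ℕ) : ℝ) - 1) * Real.exp (-(μ * p))) := by
    refine setIntegral_congr_fun measurableSet_Ioi fun x hx => ?_
    have : (((m + 2 : ℕ) : ℝ) - 1) = ((m + 1 : ℕ) : ℝ) := by push_cast; ring
    simp only [this, gammaPDFReal_nat_succ m μ (le_of_lt hx), Real.rpow_natCast, smul_eq_mul]
    ring
  rw [h1, h2, integral_const_mul, Real.integral_rpow_mul_exp_neg_mul_Ioi (by positivity) hμ,
    Real.rpow_natCast]
  have : Real.Gamma ((m + 2 : ℕ) : ℝ) = ((m + 1).factorial : ℝ) := by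
    rw [← Real.Gamma_nat_eq_factorial]; push_cast; ring_nf
  rw [this, Nat.factorial_succ]
  have : (m.factorial : ℝ) ≠ 0 := by positivity
  rw [one_div, inv_pow]
  push_cast
  field_simp
  ring

theorem integrable_id_pickLaw {n : ℕ} (hn : 1 ≤ n) {μ : ℝ} (hμ : 0 < μ) :
    Integrable (fun p : ℝ => p) (pickLaw n μ) := by
  -- The Bochner integral of a non-integrable function is `0` by convention, so a nonzero mean
  -- already proves integrability.
  apply Integrable.of_integral_ne_zero
  rw [integral_id_pickLaw hn hμ]
  have : (0 : ℝ) < n := by exact_mod_cast hn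
  positivity

/-! ### Truncated Erlang integrals. -/

/-- The derivatives of successive terms telescope. Keeping the factor `z ^ (m + 1)` avoids dividing
by `z`, so that `z = μ + s` is later allowed to vanish. -/
theorem hasDerivAt_exp_mul_sum_pow (z : ℂ) (m : ℕ) (t : ℝ) :
    HasDerivAt (fun t : ℝ => -(Complex.exp (-z * t) *
        ∑ j ∈ Finset.range (m + 1), (z * t) ^ j / (j.factorial : ℂ)))
      (z ^ (m + 1) * ((t : ℂ) ^ m / (m.factorial : ℂ) * Complex.exp (-z * t))) t := by
  have hid : HasDerivAt (fun t : ℝ => (t : ℂ)) 1 t := Complex.ofRealCLM.hasDerivAt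
  have hexp : HasDerivAt (fun t : ℝ => Complex.exp (-z * t)) (Complex.exp (-z * t) * (-z * 1)) t :=
    (hid.const_mul (-z)).cexp
  induction m with
  | zero =>
    simp only [zero_add, Finset.sum_range_one, pow_zero, Nat.factorial_zero, Nat.cast_one, div_one,
      mul_one, pow_one, one_mul]
    exact hexp.neg.congr_deriv (by ring)
  | succ m ih =>
    have h2 : HasDerivAt (fun t : ℝ => (z * t) ^ (m + 1) / ((m + 1).factorial : ℂ))
        (((m + 1 : ℕ) : ℂ) * (z * t) ^ m * (z * 1) / ((m + 1).factorial : ℂ)) t :=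
      (((hid.const_mul z).fun_pow (m + 1))).div_const _
    have h3 := ih.sub (hexp.mul h2)
    have hfun : (fun t : ℝ => -(Complex.exp (-z * t) *
        ∑ j ∈ Finset.range (m + 1 + 1), (z * t) ^ j / (j.factorial : ℂ))) =
        (fun t : ℝ => -(Complex.exp (-z * t) *
        ∑ j ∈ Finset.range (m + 1), (z * t) ^ j / (j.factorial : ℂ))) -
        (fun t : ℝ => Complex.exp (-z * t)) *
          (fun t : ℝ => (z * t) ^ (m + 1) / ((m + 1).factorial : ℂ)) := by
      funext t
      simp only [Pi.sub_apply, Pi.mul_apply]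
      rw [Finset.sum_range_succ _ (m + 1)]
      ring
    rw [hfun]
    refine h3.congr_deriv ?_
    have hm : (m.factorial : ℂ) ≠ 0 := by exact_mod_cast m.factorial_ne_zero
    have hm1 : ((m : ℂ) + 1) ≠ 0 := by exact_mod_cast m.succ_ne_zero
    rw [Nat.factorial_succ]
    push_cast
    field_simp
    ring

theorem pow_mul_integral_pow_mul_exp (z : ℂ) (m : ℕ) (T : ℝ) :
    z ^ (m + 1) * ∫ t in (0 : ℝ)..T, (t : ℂ) ^ m / (m.factorial : ℂ) * Complex.exp (-z * t) =
      1 - Complex.exp (-z * T) * ∑ j ∈ Finset.range (m + 1), (z * T) ^ j / (j.factorial : ℂ) := by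
  rw [← intervalIntegral.integral_const_mul]
  rw [intervalIntegral.integral_eq_sub_of_hasDerivAt
    (fun t _ => hasDerivAt_exp_mul_sum_pow z m t)]
  · have : ∑ j ∈ Finset.range (m + 1), (z * ((0 : ℝ) : ℂ)) ^ j / (j.factorial : ℂ) = 1 := by
      rw [Finset.sum_range_succ']
      simp
    rw [this]
    simp
    ring
  · apply Continuous.intervalIntegrable
    fun_prop

/-- For fixed `i` the sum over `j ≥ i` is geometric. With `a = μ` and `b = μ + s` this converts the
double sums in `A(s)` into the single sum that the integration over the pick time produces. -/
theorem sum_range_sum_range_mul_pow (n : ℕ) (a b : ℂ) (c : ℕ → ℂ) :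
    ∑ j ∈ Finset.range n, ∑ i ∈ Finset.range (j + 1),
        (b - a) * a ^ j * b ^ (n - j - 1 + i) * c i =
      ∑ i ∈ Finset.range n, (a ^ i * b ^ n - a ^ n * b ^ i) * c i := by
  induction n with
  | zero => simp
  | succ n ih =>
    have h1 : ∑ j ∈ Finset.range n, ∑ i ∈ Finset.range (j + 1),
        (b - a) * a ^ j * b ^ (n + 1 - j - 1 + i) * c i =
        b * ∑ j ∈ Finset.range n, ∑ i ∈ Finset.range (j + 1),
        (b - a) * a ^ j * b ^ (n - j - 1 + i) * c i := by
      simp only [Finset.mul_sum]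
      refine Finset.sum_congr rfl fun j hj => Finset.sum_congr rfl fun i _ => ?_
      rw [Finset.mem_range] at hj
      have : n + 1 - j - 1 + i = (n - j - 1 + i) + 1 := by omega
      rw [this, pow_succ]
      ring
    rw [Finset.sum_range_succ, h1, ih]
    have h2 : n + 1 - n - 1 = 0 := by omega
    simp only [h2, zero_add]
    rw [Finset.sum_range_succ _ n, Finset.sum_range_succ _ n, Finset.mul_sum, ← add_assoc,
      ← Finset.sum_add_distrib]
    congr 1
    · refine Finset.sum_congr rfl fun i _ => ?_
      ring
    · ring

/-! ### Support and regularity of the equilibrium law. -/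

/-- One step of the waiting-time recursion, as a function of `(R, P, W)`. -/
def stepMap (x : ℝ × ℝ × ℝ) : ℝ := max 0 (x.1 - x.2.1 - x.2.2)

theorem measurable_stepMap : Measurable stepMap := by
  unfold stepMap
  fun_prop

theorem integrable_of_continuous_of_ae_mem_Icc {E : Type*} [NormedAddCommGroup E]
    {ν : Measure ℝ} [IsFiniteMeasure ν] (h : ∀ᵐ x ∂ν, x ∈ Set.Icc (0 : ℝ) 1) {f : ℝ → E}
    (hf : Continuous f) : Integrable f ν := by
  rw [← Measure.restrict_eq_self_of_ae_mem h]
  exact hf.continuousOn.integrableOn_compact isCompact_Icc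

theorem ae_stepMap_mem_Icc {n : ℕ} {μ : ℝ} {ν : Measure ℝ} [SFinite ν] (hn : 1 ≤ n) (hμ : 0 < μ)
    (h0 : ∀ᵐ x ∂ν, 0 ≤ x) :
    ∀ᵐ x ∂(rotationLaw.prod ((pickLaw n μ).prod ν)), stepMap x ∈ Set.Icc (0 : ℝ) 1 := by
  have hpick := isProbabilityMeasure_pickLaw hn hμ
  have hr : ∀ᵐ r ∂rotationLaw, r < 1 := by
    filter_upwards [ae_restrict_mem measurableSet_Ico] with r hr using hr.2
  have e1 := (Measure.quasiMeasurePreserving_fst (μ := rotationLaw)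
    (ν := (pickLaw n μ).prod ν)).ae hr
  have e2 := (Measure.quasiMeasurePreserving_snd (μ := rotationLaw)
    (ν := (pickLaw n μ).prod ν)).ae (Measure.quasiMeasurePreserving_fst.ae (ae_pos_pickLaw n μ))
  have e3 := (Measure.quasiMeasurePreserving_snd (μ := rotationLaw)
    (ν := (pickLaw n μ).prod ν)).ae (Measure.quasiMeasurePreserving_snd.ae h0)
  filter_upwards [e1, e2, e3] with x h1 h2 h3
  exact ⟨le_max_left _ _, max_le zero_le_one (by linarith)⟩

theorem IsEquilibrium.ae_mem_Icc {n : ℕ} {μ : ℝ} {ν : Measure ℝ} (hn : 1 ≤ n) (hμ : 0 < μ)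
    (h : IsEquilibrium n μ ν) : ∀ᵐ x ∂ν, x ∈ Set.Icc (0 : ℝ) 1 := by
  have hprob := h.1
  have h2 : (rotationLaw.prod ((pickLaw n μ).prod ν)).map stepMap = ν := h.2
  have h0 : ∀ᵐ x ∂ν, 0 ≤ x := by
    rw [← h2, ae_map_iff measurable_stepMap.aemeasurable measurableSet_Ici]
    exact ae_of_all _ fun x => le_max_left _ _
  have h3 := ae_stepMap_mem_Icc hn hμ h0
  rw [← ae_map_iff measurable_stepMap.aemeasurable
    (p := fun x => x ∈ Set.Icc (0 : ℝ) 1) measurableSet_Icc, h2] at h3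
  exact h3

/-- Given `P` and `W`, the variable `R - P - W` is a translate of a uniform one. A subset of `(0,
1]` misses the point `0`, so the positive part plays no role there and null sets pull back to null
sets. -/
theorem IsEquilibrium.absolutelyContinuous {n : ℕ} {μ : ℝ} {ν : Measure ℝ}
    (hn : 1 ≤ n) (hμ : 0 < μ) (h : IsEquilibrium n μ ν) :
    ν.restrict (Set.Ioc 0 1) ≪ volume := by
  have hprob := h.1
  have hpick := isProbabilityMeasure_pickLaw hn hμ
  have h2 : (rotationLaw.prod ((pickLaw n μ).prod ν)).map stepMap = ν := h.2
  refine Measure.AbsolutelyContinuous.mk fun t ht ht0 => ?_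
  rw [Measure.restrict_apply ht]
  have hm : MeasurableSet (t ∩ Set.Ioc 0 1) := ht.inter measurableSet_Ioc
  conv_lhs => rw [← h2]
  rw [Measure.map_apply measurable_stepMap hm,
    Measure.prod_apply_symm (measurable_stepMap hm), lintegral_eq_zero_iff']
  · refine ae_of_all _ fun y => ?_
    have hsub : (fun r => (r, y)) ⁻¹' (stepMap ⁻¹' (t ∩ Set.Ioc 0 1)) ⊆
        (fun r => r + -(y.1 + y.2)) ⁻¹' t := by
      rintro r ⟨hrt, hr0, -⟩
      simp only [stepMap] at hrt hr0
      have hr1 : max 0 (r - y.1 - y.2) = r + -(y.1 + y.2) := by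
        rcases le_total 0 (r - y.1 - y.2) with h | h
        · rw [max_eq_right h]; ring
        · rw [max_eq_left h] at hr0
          exact absurd hr0 (lt_irrefl _)
      rw [hr1] at hrt
      exact hrt
    refine measure_mono_null hsub ?_
    rw [rotationLaw]
    refine nonpos_iff_eq_zero.1 ((Measure.restrict_apply_le _ _).trans ?_)
    rw [measure_preimage_add_right, ht0]
  · exact (measurable_measure_prodMk_right (measurable_stepMap hm)).aemeasurable

theorem integral_eq_atomZero_add {n : ℕ} {μ : ℝ} {ν : Measure ℝ} (hn : 1 ≤ n) (hμ : 0 < μ)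
    (h : IsEquilibrium n μ ν) {g : ℝ → ℂ} (hg : Continuous g) :
    ∫ x, g x ∂ν = (atomZero ν : ℂ) * g 0 + ∫ x in Set.Ioc 0 1, g x ∂ν := by
  have hprob := h.1
  have hmem := h.ae_mem_Icc hn hμ
  have hint := integrable_of_continuous_of_ae_mem_Icc hmem hg
  conv_lhs => rw [← Measure.restrict_eq_self_of_ae_mem hmem]
  have hI : Set.Icc (0 : ℝ) 1 = {0} ∪ Set.Ioc 0 1 := by
    rw [Set.singleton_union, Set.Ioc_insert_left zero_le_one]
  rw [hI, setIntegral_union (by simp) measurableSet_Ioc hint.integrableOn hint.integrableOn,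
    integral_singleton]
  simp [atomZero]

/-! ### The transform `φ` and its derivatives. -/

theorem phi_eq_integral {ν : Measure ℝ} [IsFiniteMeasure ν]
    (hac : ν.restrict (Set.Ioc 0 1) ≪ volume) (s : ℂ) :
    phi ν s = ∫ x in Set.Ioc 0 1, Complex.exp (-s * x) ∂ν := by
  rw [phi, intervalIntegral.integral_of_le zero_le_one, ← integral_indicator measurableSet_Ioc]
  have h1 : ∀ x : ℝ, (Set.Ioc (0 : ℝ) 1).indicator
      (fun x : ℝ => Complex.exp (-s * x) * (density ν x : ℂ)) x =
      ((ν.restrict (Set.Ioc 0 1)).rnDeriv volume x).toReal •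
        (Set.Ioc (0 : ℝ) 1).indicator (fun x : ℝ => Complex.exp (-s * x)) x := by
    intro x
    by_cases hx : x ∈ Set.Ioc (0 : ℝ) 1
    · simp only [Set.indicator_of_mem hx, density, Complex.real_smul]
      ring
    · simp [Set.indicator_of_notMem hx]
  simp_rw [h1]
  rw [integral_rnDeriv_smul hac, integral_indicator measurableSet_Ioc,
    Measure.restrict_restrict measurableSet_Ioc, Set.inter_self]

/-- This makes differentiation under the integral available: bounded support makes the moment
generating function finite everywhere. -/
theorem phi_eq_complexMGF {ν : Measure ℝ} [IsFiniteMeasure ν]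
    (hac : ν.restrict (Set.Ioc 0 1) ≪ volume) :
    phi ν = complexMGF (fun x => -x) (ν.restrict (Set.Ioc 0 1)) := by
  funext s
  rw [phi_eq_integral hac, complexMGF]
  refine integral_congr_ae (ae_of_all _ fun x => ?_)
  simp

theorem ae_restrict_mem_Icc (ν : Measure ℝ) :
    ∀ᵐ x ∂(ν.restrict (Set.Ioc 0 1)), x ∈ Set.Icc (0 : ℝ) 1 := by
  filter_upwards [ae_restrict_mem measurableSet_Ioc] with x hx using ⟨hx.1.le, hx.2⟩

theorem iteratedDeriv_phi {ν : Measure ℝ} [IsFiniteMeasure ν]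
    (hac : ν.restrict (Set.Ioc 0 1) ≪ volume) (l : ℕ) (s : ℂ) :
    iteratedDeriv l (phi ν) s =
      ∫ x in Set.Ioc 0 1, (-(x : ℂ)) ^ l * Complex.exp (-s * x) ∂ν := by
  have hset : integrableExpSet (fun x : ℝ => -x) (ν.restrict (Set.Ioc 0 1)) = Set.univ := by
    refine Set.eq_univ_of_forall fun t => ?_
    exact integrable_of_continuous_of_ae_mem_Icc (ae_restrict_mem_Icc ν)
      (f := fun x : ℝ => Real.exp (t * -x)) (by fun_prop)
  rw [phi_eq_complexMGF hac, iteratedDeriv_complexMGF (by simp [hset])]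
  refine integral_congr_ae (ae_of_all _ fun x => ?_)
  simp

/-- This is the source of the values `φ^{(ℓ)}(-μ)` in `A(s)`: expand `(1 + (-x)) ^ i` binomially and
recognise `(-x) ^ l e^{μx}` as the integrand of the `l`-th derivative. The atom at `0` contributes
`π₀`. -/
theorem integral_exp_mul_one_sub_pow {n : ℕ} {μ : ℝ} {ν : Measure ℝ} (hn : 1 ≤ n) (hμ : 0 < μ)
    (h : IsEquilibrium n μ ν) (i : ℕ) :
    ∫ x : ℝ, Complex.exp (μ * x) * (1 - (x : ℂ)) ^ i ∂ν =
      atomZero ν + ∑ l ∈ Finset.range (i + 1), (i.choose l : ℂ) * iteratedDeriv l (phi ν) (-μ) := by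
  have hprob := h.1
  rw [integral_eq_atomZero_add hn hμ h (by fun_prop)]
  congr 1
  · simp
  · simp_rw [iteratedDeriv_phi (h.absolutelyContinuous hn hμ), ← integral_const_mul]
    rw [← integral_finsetSum]
    · refine integral_congr_ae (ae_of_all _ fun x => ?_)
      simp only [sub_eq_neg_add, add_pow, one_pow, mul_one, neg_neg, Finset.mul_sum]
      refine Finset.sum_congr rfl fun l _ => ?_
      ring
    · intro l _
      exact integrable_of_continuous_of_ae_mem_Icc (ae_restrict_mem_Icc ν) (by fun_prop)

/-! ### The functional equation. -/

/-- Here `y` stands for `P + W`. Only `y < r < 1` contributes, and on this interval `s` times the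
integrand is an exact derivative. -/
theorem mul_integral_rotationLaw (s : ℂ) {y : ℝ} (hy : 0 ≤ y) :
    s * ∫ r, (Set.Ioc (0 : ℝ) 1).indicator (fun x : ℝ => Complex.exp (-s * (1 - x)))
        (max 0 (r - y)) ∂rotationLaw =
      if y < 1 then Complex.exp (-s * y) - Complex.exp (-s) else 0 := by
  have h1 : ∫ r, (Set.Ioc (0 : ℝ) 1).indicator (fun x : ℝ => Complex.exp (-s * (1 - x)))
        (max 0 (r - y)) ∂rotationLaw =
      ∫ r in Set.Ico (0 : ℝ) 1, (Set.Ioi y).indicator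
        (fun r : ℝ => Complex.exp (-s * (1 - r + y))) r := by
    refine setIntegral_congr_fun measurableSet_Ico fun r hr => ?_
    by_cases hry : y < r
    · have hmax : max 0 (r - y) = r - y := max_eq_right (by linarith)
      have hmem : r - y ∈ Set.Ioc (0 : ℝ) 1 := ⟨by linarith, by linarith [hr.2]⟩
      simp only [hmax, Set.indicator_of_mem hmem, Set.indicator_of_mem (Set.mem_Ioi.2 hry)]
      push_cast
      ring_nf
    · have hmax : max 0 (r - y) = 0 := max_eq_left (by linarith)
      simp [hmax, hry]
  rw [h1, setIntegral_indicator measurableSet_Ioi]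
  split_ifs with hy1
  · have hset : Set.Ico (0 : ℝ) 1 ∩ Set.Ioi y = Set.Ioo y 1 := by
      ext r
      simp only [Set.mem_inter_iff, Set.mem_Ico, Set.mem_Ioi, Set.mem_Ioo]
      constructor
      · rintro ⟨⟨-, h⟩, h'⟩; exact ⟨h', h⟩
      · rintro ⟨h', h⟩; exact ⟨⟨by linarith, h⟩, h'⟩
    rw [hset, ← integral_Ioc_eq_integral_Ioo, ← intervalIntegral.integral_of_le hy1.le,
      ← intervalIntegral.integral_const_mul]
    have hder : ∀ r ∈ Set.uIcc y 1, HasDerivAt (fun r : ℝ => Complex.exp (-s * (1 - r + y)))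
        (s * Complex.exp (-s * (1 - r + y))) r := by
      intro r _
      have hid : HasDerivAt (fun t : ℝ => (t : ℂ)) 1 r := Complex.ofRealCLM.hasDerivAt
      exact ((((hid.const_sub 1).add_const (y : ℂ)).const_mul (-s)).cexp).congr_deriv (by ring)
    rw [intervalIntegral.integral_eq_sub_of_hasDerivAt hder
      (Continuous.intervalIntegrable (by fun_prop) _ _)]
    push_cast
    ring_nf
  · have hset : Set.Ico (0 : ℝ) 1 ∩ Set.Ioi y = ∅ := by
      ext r
      simp only [Set.mem_inter_iff, Set.mem_Ico, Set.mem_Ioi, Set.mem_empty_iff_false, iff_false]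
      rintro ⟨⟨-, h⟩, h'⟩
      linarith
    simp [hset]

/-- The two exponentials lead to Erlang integrals over `[0, 1 - w]` with rates `μ + s` and `μ`.
Their boundary terms at `1 - w` share the factor `e^{-(μ+s)} e^{μw}` and merge into one sum. -/
theorem pow_mul_integral_pickLaw {n : ℕ} (hn : 1 ≤ n) {μ : ℝ} (hμ : 0 < μ) (s : ℂ) {w : ℝ}
    (hw : w ≤ 1) :
    (μ + s) ^ n * ∫ p, (if p + w < 1 then
        Complex.exp (-s * ((p + w : ℝ) : ℂ)) - Complex.exp (-s) else 0) ∂(pickLaw n μ) =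
      (μ : ℂ) ^ n * Complex.exp (-s * w) - (μ + s) ^ n * Complex.exp (-s) +
        Complex.exp (-(μ + s)) * ∑ i ∈ Finset.range n,
          ((μ : ℂ) ^ i * (μ + s) ^ n - (μ : ℂ) ^ n * (μ + s) ^ i) / (i.factorial : ℂ) *
            (Complex.exp (μ * w) * (1 - (w : ℂ)) ^ i) := by
  obtain ⟨m, rfl⟩ : ∃ m, n = m + 1 := ⟨n - 1, by omega⟩
  have h1 : ∫ p, (if p + w < 1 then
        Complex.exp (-s * ((p + w : ℝ) : ℂ)) - Complex.exp (-s) else 0) ∂(pickLaw (m + 1) μ) =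
      ∫ p in (0 : ℝ)..(1 - w), ((μ : ℂ) ^ (m + 1) * Complex.exp (-s * w) *
        ((p : ℂ) ^ m / (m.factorial : ℂ) * Complex.exp (-(μ + s) * p)) -
        (μ : ℂ) ^ (m + 1) * Complex.exp (-s) *
        ((p : ℂ) ^ m / (m.factorial : ℂ) * Complex.exp (-μ * p))) := by
    rw [integral_pickLaw_eq hn hμ, intervalIntegral.integral_of_le (by linarith),
      integral_Ioc_eq_integral_Ioo, ← integral_Ico_eq_integral_Ioo,
      ← integral_indicator measurableSet_Ico]
    refine integral_congr_ae (ae_of_all _ fun p => ?_)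
    simp only
    by_cases hp : p ∈ Set.Ico 0 (1 - w)
    · have hp1 : p + w < 1 := by linarith [hp.2]
      rw [Set.indicator_of_mem hp, if_pos hp1, gammaPDFReal_nat_succ m μ hp.1, Complex.real_smul]
      have e1 : Complex.exp (-(μ + s) * p) = Complex.exp (-μ * p) * Complex.exp (-s * p) := by
        rw [← Complex.exp_add]; ring_nf
      have e2 : Complex.exp (-s * ((p + w : ℝ) : ℂ)) =
          Complex.exp (-s * p) * Complex.exp (-s * w) := by
        rw [← Complex.exp_add]; push_cast; ring_nf
      rw [e1, e2]
      push_cast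
      ring_nf
    · rw [Set.indicator_of_notMem hp]
      by_cases hp0 : 0 ≤ p
      · rw [if_neg (fun h => hp ⟨hp0, by linarith⟩), smul_zero]
      · simp [gammaPDFReal, hp0]
  rw [h1, intervalIntegral.integral_sub (Continuous.intervalIntegrable (by fun_prop) _ _)
    (Continuous.intervalIntegrable (by fun_prop) _ _),
    intervalIntegral.integral_const_mul, intervalIntegral.integral_const_mul]
  have h2 := pow_mul_integral_pow_mul_exp (μ + s) m (1 - w)
  have h3 := pow_mul_integral_pow_mul_exp μ m (1 - w)
  set I1 := ∫ t in (0 : ℝ)..(1 - w), (t : ℂ) ^ m / (m.factorial : ℂ) * Complex.exp (-(μ + s) * t)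
  set I2 := ∫ t in (0 : ℝ)..(1 - w), (t : ℂ) ^ m / (m.factorial : ℂ) * Complex.exp (-μ * t)
  have e1 : Complex.exp (-s * w) * Complex.exp (-(μ + s) * ((1 - w : ℝ) : ℂ)) =
      Complex.exp (-(μ + s)) * Complex.exp (μ * w) := by
    rw [← Complex.exp_add, ← Complex.exp_add]; push_cast; ring_nf
  have e2 : Complex.exp (-s) * Complex.exp (-μ * ((1 - w : ℝ) : ℂ)) =
      Complex.exp (-(μ + s)) * Complex.exp (μ * w) := by
    rw [← Complex.exp_add, ← Complex.exp_add]; push_cast; ring_nf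
  have h4 : Complex.exp (-(μ + s)) * ∑ i ∈ Finset.range (m + 1),
          ((μ : ℂ) ^ i * (μ + s) ^ (m + 1) - (μ : ℂ) ^ (m + 1) * (μ + s) ^ i) /
            (i.factorial : ℂ) * (Complex.exp (μ * w) * (1 - (w : ℂ)) ^ i) =
      (μ + s) ^ (m + 1) * (Complex.exp (-(μ + s)) * Complex.exp (μ * w)) *
        ∑ j ∈ Finset.range (m + 1), (μ * ((1 - w : ℝ) : ℂ)) ^ j / (j.factorial : ℂ) -
      (μ : ℂ) ^ (m + 1) * (Complex.exp (-(μ + s)) * Complex.exp (μ * w)) *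
        ∑ j ∈ Finset.range (m + 1), ((μ + s) * ((1 - w : ℝ) : ℂ)) ^ j / (j.factorial : ℂ) := by
    simp only [Finset.mul_sum]
    rw [← Finset.sum_sub_distrib]
    refine Finset.sum_congr rfl fun i _ => ?_
    push_cast
    rw [mul_pow, mul_pow]
    ring
  rw [h4]
  set S1 := ∑ j ∈ Finset.range (m + 1), ((μ + s) * ((1 - w : ℝ) : ℂ)) ^ j / (j.factorial : ℂ)
  set S2 := ∑ j ∈ Finset.range (m + 1), (μ * ((1 - w : ℝ) : ℂ)) ^ j / (j.factorial : ℂ)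
  linear_combination (μ : ℂ) ^ (m + 1) * Complex.exp (-s * w) * h2
    - (μ + s) ^ (m + 1) * Complex.exp (-s) * h3
    - (μ : ℂ) ^ (m + 1) * S1 * e1 + (μ + s) ^ (m + 1) * S2 * e2

theorem IsEquilibrium.integral_eq {n : ℕ} {μ : ℝ} {ν : Measure ℝ} (hn : 1 ≤ n) (hμ : 0 < μ)
    (h : IsEquilibrium n μ ν) {g : ℝ → ℂ} (hg : Measurable g) (C : ℝ) (hC : ∀ x, ‖g x‖ ≤ C) :
    ∫ x, g x ∂ν =
      ∫ w, ∫ p, ∫ r, g (max 0 (r - (p + w))) ∂rotationLaw ∂(pickLaw n μ) ∂ν := by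
  have hprob := h.1
  have hpick := isProbabilityMeasure_pickLaw hn hμ
  have h2 : (rotationLaw.prod ((pickLaw n μ).prod ν)).map stepMap = ν := h.2
  have hint : Integrable (fun x => g (stepMap x)) (rotationLaw.prod ((pickLaw n μ).prod ν)) :=
    Integrable.of_bound (hg.comp measurable_stepMap).aestronglyMeasurable C
      (ae_of_all _ fun x => hC _)
  conv_lhs => rw [← h2]
  rw [integral_map measurable_stepMap.aemeasurable hg.aestronglyMeasurable,
    integral_prod_symm _ hint, integral_prod_symm _ hint.integral_prod_right]
  simp only [stepMap, sub_sub]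

theorem phi_functional_equation {n : ℕ} {μ : ℝ} {ν : Measure ℝ} (hn : 1 ≤ n) (hμ : 0 < μ)
    (h : IsEquilibrium n μ ν) (s : ℂ) :
    Complex.exp (-s) * s * (μ + s) ^ n * phi ν (-s) = (μ : ℂ) ^ n * phi ν s + funA n μ ν s := by
  have hprob := h.1
  have hpick := isProbabilityMeasure_pickLaw hn hμ
  have hmem := h.ae_mem_Icc hn hμ
  have hac := h.absolutelyContinuous hn hμ
  -- The test function vanishes at the atom and its mean is `e^{-s} φ(-s)`, while the integrations
  -- over `R` and `P` return `e^{-sw}`, hence `φ(s)`.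
  set g : ℝ → ℂ := (Set.Ioc (0 : ℝ) 1).indicator (fun x : ℝ => Complex.exp (-s * (1 - x))) with hg
  have hgm : Measurable g := Measurable.indicator (by fun_prop) measurableSet_Ioc
  obtain ⟨C, hC⟩ : ∃ C : ℝ, ∀ x, ‖g x‖ ≤ C := by
    obtain ⟨C, hC⟩ := isCompact_Icc.exists_bound_of_continuousOn
      (f := fun x : ℝ => Complex.exp (-s * (1 - x))) (s := Set.Icc 0 1)
      (by fun_prop : Continuous _).continuousOn
    refine ⟨C, fun x => ?_⟩
    by_cases hx : x ∈ Set.Ioc (0 : ℝ) 1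
    · rw [hg, Set.indicator_of_mem hx]
      exact hC x ⟨hx.1.le, hx.2⟩
    · rw [hg, Set.indicator_of_notMem hx, norm_zero]
      exact (norm_nonneg _).trans (hC 0 (by simp))
  have h1 : Complex.exp (-s) * phi ν (-s) = ∫ x, g x ∂ν := by
    rw [phi_eq_integral hac, hg, integral_indicator measurableSet_Ioc, ← integral_const_mul]
    refine integral_congr_ae (ae_of_all _ fun x => ?_)
    simp only [← Complex.exp_add]
    ring_nf
  have h2 : (μ + s) ^ n * (s * ∫ x, g x ∂ν) =
      ∫ w : ℝ, ((μ : ℂ) ^ n * Complex.exp (-s * w) - (μ + s) ^ n * Complex.exp (-s) +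
        Complex.exp (-(μ + s)) * ∑ i ∈ Finset.range n,
          ((μ : ℂ) ^ i * (μ + s) ^ n - (μ : ℂ) ^ n * (μ + s) ^ i) / (i.factorial : ℂ) *
            (Complex.exp (μ * w) * (1 - (w : ℂ)) ^ i)) ∂ν := by
    rw [h.integral_eq hn hμ hgm C hC, ← integral_const_mul, ← integral_const_mul]
    refine integral_congr_ae ?_
    filter_upwards [hmem] with w hw
    rw [← pow_mul_integral_pickLaw hn hμ s hw.2, ← integral_const_mul]
    congr 1
    refine integral_congr_ae ?_
    filter_upwards [ae_pos_pickLaw n μ] with p hp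
    exact mul_integral_rotationLaw s (by linarith [hw.1])
  have hcont : ∀ f : ℝ → ℂ, Continuous f → Integrable f ν := fun f hf =>
    integrable_of_continuous_of_ae_mem_Icc hmem hf
  have h3 : ∫ w : ℝ, Complex.exp (-s * w) ∂ν = atomZero ν + phi ν s := by
    rw [integral_eq_atomZero_add hn hμ h (by fun_prop), phi_eq_integral hac]
    simp
  rw [integral_add (hcont _ (by fun_prop)) (hcont _ (by fun_prop)),
    integral_sub (hcont _ (by fun_prop)) (hcont _ (by fun_prop)), integral_const_mul,
    integral_const_mul, integral_const_mul, integral_finsetSum _ (fun i _ => hcont _ (by fun_prop)), h3] at h2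
  simp_rw [integral_const_mul, integral_exp_mul_one_sub_pow hn hμ h] at h2
  rw [integral_const, probReal_univ, one_smul] at h2
  have halg := sum_range_sum_range_mul_pow n (μ : ℂ) (μ + s)
    (fun i => (atomZero ν + ∑ l ∈ Finset.range (i + 1),
      (i.choose l : ℂ) * iteratedDeriv l (phi ν) (-μ)) / (i.factorial : ℂ))
  have h4 : funA n μ ν s = (atomZero ν : ℂ) * (μ : ℂ) ^ n - Complex.exp (-s) * (μ + s) ^ n +
      Complex.exp (-(μ + s)) * ∑ i ∈ Finset.range n,
        ((μ : ℂ) ^ i * (μ + s) ^ n - (μ : ℂ) ^ n * (μ + s) ^ i) / (i.factorial : ℂ) *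
          (atomZero ν + ∑ l ∈ Finset.range (i + 1),
            (i.choose l : ℂ) * iteratedDeriv l (phi ν) (-μ)) := by
    have h5 : ∑ i ∈ Finset.range n,
        ((μ : ℂ) ^ i * (μ + s) ^ n - (μ : ℂ) ^ n * (μ + s) ^ i) / (i.factorial : ℂ) *
          (atomZero ν + ∑ l ∈ Finset.range (i + 1),
            (i.choose l : ℂ) * iteratedDeriv l (phi ν) (-μ)) =
        (atomZero ν : ℂ) * (∑ j ∈ Finset.range n, ∑ i ∈ Finset.range (j + 1),
          s * (μ : ℂ) ^ j * (μ + s) ^ (n - j - 1 + i) / (Nat.factorial i : ℂ)) +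
        ∑ j ∈ Finset.range n, ∑ i ∈ Finset.range (j + 1), ∑ l ∈ Finset.range (i + 1),
          (Nat.choose i l : ℂ) *
          (s * (μ : ℂ) ^ j * (μ + s) ^ (n - j - 1 + i) / (Nat.factorial i : ℂ)) *
          iteratedDeriv l (phi ν) (-μ) := by
      trans ∑ i ∈ Finset.range n, ((μ : ℂ) ^ i * (μ + s) ^ n - (μ : ℂ) ^ n * (μ + s) ^ i) *
        ((atomZero ν + ∑ l ∈ Finset.range (i + 1),
          (i.choose l : ℂ) * iteratedDeriv l (phi ν) (-μ)) / (i.factorial : ℂ))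
      · exact Finset.sum_congr rfl fun i _ => by ring
      · rw [← halg, Finset.mul_sum, ← Finset.sum_add_distrib]
        refine Finset.sum_congr rfl fun j _ => ?_
        rw [Finset.mul_sum, ← Finset.sum_add_distrib]
        refine Finset.sum_congr rfl fun i _ => ?_
        rw [add_div, mul_add, Finset.sum_div, Finset.mul_sum]
        congr 1
        · ring
        · exact Finset.sum_congr rfl fun l _ => by ring
    rw [h5, funA]
    ring
  rw [h4]
  linear_combination h2 + (μ + s) ^ n * s * h1

/-- The functional equations at `s` and `-s` form a linear system in `φ(s)` and `φ(-s)`. Eliminating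
`φ(-s)` leaves `R(s)` as the coefficient of `φ(s)`. -/
theorem polyR_mul_phi {n : ℕ} {μ : ℝ} {ν : Measure ℝ} (hn : 1 ≤ n) (hμ : 0 < μ)
    (h : IsEquilibrium n μ ν) (s : ℂ) :
    (polyR n μ).eval s * phi ν s =
      (polyP n μ ν).eval s + Complex.exp (-s) * (polyQ n μ ν).eval s := by
  rw [polyP_add_polyQ, polyR_eval]
  have h1 := phi_functional_equation hn hμ h s
  have h2 := phi_functional_equation hn hμ h (-s)
  rw [neg_neg] at h2
  have e : Complex.exp (-s) * Complex.exp s = 1 := by rw [← Complex.exp_add]; simp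
  have hpow : ((μ : ℂ) ^ 2 - s ^ 2) ^ n = (μ + s) ^ n * (μ + -s) ^ n := by
    rw [← mul_pow]; ring
  rw [hpow, two_mul, pow_add]
  linear_combination (-(μ : ℂ) ^ n) * h1 - Complex.exp (-s) * s * (μ + s) ^ n * h2
    - s ^ 2 * (μ + s) ^ n * (μ + -s) ^ n * phi ν s * e

/-! ### Explicit transform and mean waiting time. -/

/-- The explicit form of the Laplace transform of the equilibrium density away from the zeros
of `R`. -/
theorem phi_eq_sum {n : ℕ} {μ : ℝ} {ν : Measure ℝ} (hn : 1 ≤ n) (hμ : 0 < μ)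
    (h : IsEquilibrium n μ ν) {r : Fin (2 * n + 2) → ℂ}
    (hr : (polyR n μ).roots = Finset.univ.val.map r) {s : ℂ} (hs : (polyR n μ).eval s ≠ 0) :
    phi ν s = ∑ i, coeffC n μ ν (r i) * ((1 - Complex.exp (r i - s)) / (s - r i)) := by
  have hroot : ∀ i, (polyR n μ).eval (r i) = 0 := by
    intro i
    have : r i ∈ (polyR n μ).roots := by
      rw [hr, Multiset.mem_map]
      exact ⟨i, Finset.mem_univ i, rfl⟩
    exact (mem_roots (polyR_ne_zero hμ)).1 this
  have hsimple := fun i => polyR_simple_root hn hμ (hroot i)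
  have hP := eval_div_eval_eq_sum (polyR_ne_zero hμ) hr hsimple (degree_polyP_lt n μ ν) hs
  have hQ := eval_div_eval_eq_sum (polyR_ne_zero hμ) hr hsimple (degree_polyQ_lt n μ ν) hs
  -- Since `φ(r i)` is finite, the left side of `polyR_mul_phi` vanishes at `r i`; this ties the
  -- residues of `Q / R` to those of `P / R`.
  have hQr : ∀ i, (polyQ n μ ν).eval (r i) =
      -(Complex.exp (r i) * (polyP n μ ν).eval (r i)) := by
    intro i
    have h1 := polyR_mul_phi hn hμ h (r i)
    rw [hroot, zero_mul] at h1
    have e : Complex.exp (-(r i)) * Complex.exp (r i) = 1 := by rw [← Complex.exp_add]; simp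
    linear_combination (-Complex.exp (r i)) * h1 - (polyQ n μ ν).eval (r i) * e
  have h1 : phi ν s = (polyP n μ ν).eval s / (polyR n μ).eval s +
      Complex.exp (-s) * ((polyQ n μ ν).eval s / (polyR n μ).eval s) := by
    field_simp
    rw [mul_comm (phi ν s)]
    exact polyR_mul_phi hn hμ h s
  rw [h1, hP, hQ, Finset.mul_sum, ← Finset.sum_add_distrib]
  refine Finset.sum_congr rfl fun i _ => ?_
  rw [hQr, coeffC, sub_eq_add_neg (r i), Complex.exp_add]
  ring

/-- The mean is `-φ'(0)`, to which the atom at `0` adds nothing. As `R(0) ≠ 0`, the explicit formula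
holds in a neighbourhood of `0` and may be differentiated there. -/
theorem integral_id_equilibrium {n : ℕ} {μ : ℝ} {ν : Measure ℝ} (hn : 1 ≤ n) (hμ : 0 < μ)
    (h : IsEquilibrium n μ ν) {r : Fin (2 * n + 2) → ℂ}
    (hr : (polyR n μ).roots = Finset.univ.val.map r) (hr0 : ∀ i, r i ≠ 0) :
    ((∫ w, w ∂ν : ℝ) : ℂ) =
      ∑ i, coeffC n μ ν (r i) / (r i) ^ 2 * (1 + (r i - 1) * Complex.exp (r i)) := by
  have hprob := h.1
  have h1 : deriv (phi ν) 0 = -((∫ w, w ∂ν : ℝ) : ℂ) := by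
    rw [← iteratedDeriv_one, iteratedDeriv_phi (h.absolutelyContinuous hn hμ), ← integral_complex_ofReal,
      integral_eq_atomZero_add hn hμ h (by fun_prop)]
    simp [integral_neg]
  have h2 : deriv (phi ν) 0 =
      ∑ i, coeffC n μ ν (r i) * -((1 + (r i - 1) * Complex.exp (r i)) / (r i) ^ 2) := by
    have hev : phi ν =ᶠ[𝓝 0]
        fun s => ∑ i, coeffC n μ ν (r i) * ((1 - Complex.exp (r i - s)) / (s - r i)) := by
      have hne : ∀ᶠ s in 𝓝 (0 : ℂ), (polyR n μ).eval s ≠ 0 :=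
        (polyR n μ).continuous.continuousAt.eventually_ne (polyR_eval_zero_ne hμ)
      filter_upwards [hne] with s hs using phi_eq_sum hn hμ h hr hs
    rw [hev.deriv_eq]
    refine HasDerivAt.deriv (HasDerivAt.fun_sum fun i _ => HasDerivAt.const_mul _ ?_)
    have hnum : HasDerivAt (fun s : ℂ => 1 - Complex.exp (r i - s))
        (-(Complex.exp (r i - 0) * (-1))) 0 :=
      ((hasDerivAt_id (0 : ℂ)).const_sub (r i)).cexp.const_sub 1
    have hden : HasDerivAt (fun s : ℂ => s - r i) 1 0 := (hasDerivAt_id (0 : ℂ)).sub_const _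
    refine (hnum.fun_div hden (by simpa using hr0 i)).congr_deriv ?_
    have := hr0 i
    rw [sub_zero]
    field_simp
    ring
  rw [h2] at h1
  rw [← neg_inj, ← h1, ← Finset.sum_neg_distrib]
  refine Finset.sum_congr rfl fun i _ => ?_
  ring

/-! ### Existence, uniqueness and geometric convergence. -/

/-- The law of `(R - P - W)^+` when `W` has law `ν`. -/
noncomputable def stepLaw (n : ℕ) (μ : ℝ) (ν : Measure ℝ) : Measure ℝ :=
  (rotationLaw.prod ((pickLaw n μ).prod ν)).map stepMap

/-- The part of `stepLaw` carried by the event `P < R`, on which the next waiting time depends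
on the present one. -/
noncomputable def coupledStep (n : ℕ) (μ : ℝ) (ν : Measure ℝ) : Measure ℝ :=
  ((rotationLaw.prod ((pickLaw n μ).prod ν)).restrict {x | x.2.1 < x.1}).map stepMap

/-- The probability of the event `P < R`. -/
noncomputable def couplingMass (n : ℕ) (μ : ℝ) : ENNReal :=
  (rotationLaw.prod (pickLaw n μ)) {x | x.2 < x.1}

/-- The part of `stepLaw` carried by the event `R ≤ P`. -/
noncomputable def resetLaw (n : ℕ) (μ : ℝ) : Measure ℝ :=
  (1 - couplingMass n μ) • Measure.dirac 0

theorem measurableSet_fst_snd_lt : MeasurableSet {x : ℝ × ℝ × ℝ | x.2.1 < x.1} :=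
  measurableSet_lt (by fun_prop) (by fun_prop)

section

variable {n : ℕ} {μ : ℝ}

theorem prod_prod_lt_eq (hn : 1 ≤ n) (hμ : 0 < μ) (ν : Measure ℝ) [SFinite ν] :
    (rotationLaw.prod ((pickLaw n μ).prod ν)) {x | x.2.1 < x.1} =
      couplingMass n μ * ν Set.univ := by
  have hpick := isProbabilityMeasure_pickLaw hn hμ
  rw [couplingMass, Measure.prod_apply measurableSet_fst_snd_lt,
    Measure.prod_apply (measurableSet_lt measurable_snd measurable_fst),
    ← lintegral_mul_const'' _ (by
      exact (measurable_measure_prodMk_left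
        (measurableSet_lt measurable_snd measurable_fst)).aemeasurable)]
  refine lintegral_congr fun r => ?_
  have : Prod.mk r ⁻¹' {x : ℝ × ℝ × ℝ | x.2.1 < x.1} =
      (Prod.mk r ⁻¹' {x : ℝ × ℝ | x.2 < x.1}) ×ˢ Set.univ := by
    ext y; simp
  rw [this, Measure.prod_prod]

/-- A pick time of at least `1` beats every rotation time, and it occurs with positive probability.
This is the contraction behind everything that follows. -/
theorem couplingMass_lt_one (hn : 1 ≤ n) (hμ : 0 < μ) : couplingMass n μ < 1 := by
  have hpick := isProbabilityMeasure_pickLaw hn hμ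
  have hsub : (Set.univ : Set ℝ) ×ˢ Set.Ici (1 : ℝ) =ᵐ[rotationLaw.prod (pickLaw n μ)]
      (Set.Iio (1 : ℝ) ×ˢ Set.Ici (1 : ℝ) : Set (ℝ × ℝ)) := by
    have hr : ∀ᵐ r ∂rotationLaw, r < 1 := by
      filter_upwards [ae_restrict_mem measurableSet_Ico] with r hr using hr.2
    filter_upwards [(Measure.quasiMeasurePreserving_fst (μ := rotationLaw)
      (ν := pickLaw n μ)).ae hr] with x hx
    refine propext ?_
    change (x ∈ Set.univ ×ˢ Set.Ici (1 : ℝ)) ↔ x ∈ Set.Iio (1 : ℝ) ×ˢ Set.Ici (1 : ℝ)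
    simp [Set.mem_prod, hx]
  have hpos : (rotationLaw.prod (pickLaw n μ)) (Set.Iio (1 : ℝ) ×ˢ Set.Ici (1 : ℝ)) ≠ 0 := by
    rw [← measure_congr hsub, Measure.prod_prod, measure_univ, one_mul]
    exact pickLaw_Ici_one_ne_zero hn hμ
  have hle : couplingMass n μ ≤
      (rotationLaw.prod (pickLaw n μ)) (Set.Iio (1 : ℝ) ×ˢ Set.Ici (1 : ℝ))ᶜ := by
    refine measure_mono fun x hx hx2 => ?_
    have h1 : x.1 < 1 := hx2.1
    have h2 : 1 ≤ x.2 := hx2.2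
    have h3 : x.2 < x.1 := hx
    linarith
  refine hle.trans_lt ?_
  rw [prob_compl_eq_one_sub (measurableSet_Iio.prod measurableSet_Ici)]
  exact ENNReal.sub_lt_self ENNReal.one_ne_top one_ne_zero hpos

theorem coupledStep_univ (hn : 1 ≤ n) (hμ : 0 < μ) (ν : Measure ℝ) [SFinite ν] :
    coupledStep n μ ν Set.univ = couplingMass n μ * ν Set.univ := by
  rw [coupledStep, Measure.map_apply measurable_stepMap MeasurableSet.univ, Set.preimage_univ,
    Measure.restrict_apply_univ, prod_prod_lt_eq hn hμ]

theorem isFiniteMeasure_coupledStep (hn : 1 ≤ n) (hμ : 0 < μ) (ν : Measure ℝ)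
    [IsFiniteMeasure ν] : IsFiniteMeasure (coupledStep n μ ν) := by
  refine ⟨?_⟩
  rw [coupledStep_univ hn hμ]
  exact ENNReal.mul_lt_top ((couplingMass_lt_one hn hμ).trans ENNReal.one_lt_top)
    (measure_lt_top _ _)

theorem coupledStep_add (hn : 1 ≤ n) (hμ : 0 < μ) (ν ν' : Measure ℝ) [SFinite ν] [SFinite ν'] :
    coupledStep n μ (ν + ν') = coupledStep n μ ν + coupledStep n μ ν' := by
  have hpick := isProbabilityMeasure_pickLaw hn hμ
  simp only [coupledStep]
  rw [Measure.prod_add, Measure.prod_add, Measure.restrict_add, Measure.map_add _ _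
    measurable_stepMap]

theorem coupledStep_sum (hn : 1 ≤ n) (hμ : 0 < μ) (ν : ℕ → Measure ℝ) [∀ k, SFinite (ν k)] :
    coupledStep n μ (Measure.sum ν) = Measure.sum fun k => coupledStep n μ (ν k) := by
  have hpick := isProbabilityMeasure_pickLaw hn hμ
  simp only [coupledStep]
  rw [Measure.prod_sum_right, Measure.prod_sum_right, Measure.restrict_sum_of_countable,
    Measure.map_sum measurable_stepMap.aemeasurable]

/-- When `R ≤ P` and `W ≥ 0` the positive part is `0`, so this event contributes a point mass that
does not depend on `ν`. -/
theorem stepLaw_eq (hn : 1 ≤ n) (hμ : 0 < μ) {ν : Measure ℝ} [IsProbabilityMeasure ν]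
    (h0 : ∀ᵐ x ∂ν, 0 ≤ x) : stepLaw n μ ν = resetLaw n μ + coupledStep n μ ν := by
  have hpick := isProbabilityMeasure_pickLaw hn hμ
  have hsplit : stepLaw n μ ν = coupledStep n μ ν +
      ((rotationLaw.prod ((pickLaw n μ).prod ν)).restrict {x | x.2.1 < x.1}ᶜ).map stepMap := by
    rw [stepLaw, coupledStep, ← Measure.map_add _ _ measurable_stepMap,
      Measure.restrict_add_restrict_compl measurableSet_fst_snd_lt]
  rw [hsplit, add_comm]
  congr 1
  have e3 := (Measure.quasiMeasurePreserving_snd (μ := rotationLaw)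
    (ν := (pickLaw n μ).prod ν)).ae (Measure.quasiMeasurePreserving_snd.ae h0)
  have hconst : stepMap =ᵐ[(rotationLaw.prod ((pickLaw n μ).prod ν)).restrict
      {x | x.2.1 < x.1}ᶜ] fun _ => (0 : ℝ) := by
    filter_upwards [ae_restrict_of_ae e3,
      ae_restrict_mem measurableSet_fst_snd_lt.compl] with x hx1 hx2
    have : ¬ x.2.1 < x.1 := hx2
    exact max_eq_left (by linarith)
  rw [Measure.map_congr hconst, Measure.map_const, Measure.restrict_apply_univ,
    prob_compl_eq_one_sub measurableSet_fst_snd_lt, prod_prod_lt_eq hn hμ, measure_univ, mul_one,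
    resetLaw]

theorem ae_stepLaw (hn : 1 ≤ n) (hμ : 0 < μ) {ν : Measure ℝ} [SFinite ν]
    (h0 : ∀ᵐ x ∂ν, 0 ≤ x) : ∀ᵐ x ∂(stepLaw n μ ν), x ∈ Set.Icc (0 : ℝ) 1 := by
  rw [stepLaw, ae_map_iff measurable_stepMap.aemeasurable
    (p := fun x => x ∈ Set.Icc (0 : ℝ) 1) measurableSet_Icc]
  exact ae_stepMap_mem_Icc hn hμ h0

theorem isProbabilityMeasure_stepLaw (hn : 1 ≤ n) (hμ : 0 < μ) (ν : Measure ℝ)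
    [IsProbabilityMeasure ν] : IsProbabilityMeasure (stepLaw n μ ν) := by
  have hpick := isProbabilityMeasure_pickLaw hn hμ
  exact Measure.isProbabilityMeasure_map measurable_stepMap.aemeasurable

theorem isFiniteMeasure_iterate_coupledStep (hn : 1 ≤ n) (hμ : 0 < μ) (ν : Measure ℝ)
    [IsFiniteMeasure ν] (k : ℕ) : IsFiniteMeasure ((coupledStep n μ)^[k] ν) := by
  induction k with
  | zero => simpa
  | succ k ih =>
    rw [Function.iterate_succ_apply']
    exact isFiniteMeasure_coupledStep hn hμ _

theorem iterate_coupledStep_univ (hn : 1 ≤ n) (hμ : 0 < μ) (ν : Measure ℝ)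
    [IsFiniteMeasure ν] (k : ℕ) :
    (coupledStep n μ)^[k] ν Set.univ = couplingMass n μ ^ k * ν Set.univ := by
  induction k with
  | zero => simp
  | succ k ih =>
    have := isFiniteMeasure_iterate_coupledStep hn hμ ν k
    rw [Function.iterate_succ_apply', coupledStep_univ hn hμ, ih, pow_succ]
    ring

theorem isProbabilityMeasure_iterate_stepLaw (hn : 1 ≤ n) (hμ : 0 < μ) (ν : Measure ℝ)
    [IsProbabilityMeasure ν] (k : ℕ) : IsProbabilityMeasure ((stepLaw n μ)^[k] ν) := by
  induction k with
  | zero => simpa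
  | succ k ih =>
    rw [Function.iterate_succ_apply']
    exact isProbabilityMeasure_stepLaw hn hμ _

theorem ae_iterate_stepLaw (hn : 1 ≤ n) (hμ : 0 < μ) {ν : Measure ℝ} [IsProbabilityMeasure ν]
    (h0 : ∀ᵐ x ∂ν, x ∈ Set.Icc (0 : ℝ) 1) (k : ℕ) :
    ∀ᵐ x ∂((stepLaw n μ)^[k] ν), x ∈ Set.Icc (0 : ℝ) 1 := by
  induction k with
  | zero => exact h0
  | succ k ih =>
    have := isProbabilityMeasure_iterate_stepLaw hn hμ ν k
    rw [Function.iterate_succ_apply']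
    exact ae_stepLaw hn hμ (ih.mono fun x hx => hx.1)

/-- The `k`-step laws from any two starting distributions share a common part, of mass
`1 - q ^ k` with `q = couplingMass n μ`. -/
theorem exists_iterate_stepLaw_eq (hn : 1 ≤ n) (hμ : 0 < μ) (k : ℕ) :
    ∃ κ : Measure ℝ, IsFiniteMeasure κ ∧ ∀ ν : Measure ℝ, IsProbabilityMeasure ν →
      (∀ᵐ x ∂ν, x ∈ Set.Icc (0 : ℝ) 1) →
      (stepLaw n μ)^[k] ν = κ + (coupledStep n μ)^[k] ν := by
  induction k with
  | zero => exact ⟨0, inferInstance, fun ν _ _ => by simp⟩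
  | succ k ih =>
    obtain ⟨κ, hκ, h⟩ := ih
    have hf := isFiniteMeasure_coupledStep hn hμ κ
    have hreset : IsFiniteMeasure (resetLaw n μ) :=
      Measure.smul_finite _ (tsub_le_self.trans_lt ENNReal.one_lt_top).ne
    -- By additivity of `coupledStep` the common part evolves by itself, gaining a fresh reset at
    -- each step.
    refine ⟨resetLaw n μ + coupledStep n μ κ, inferInstance, fun ν hν h0 => ?_⟩
    have h1 := isProbabilityMeasure_iterate_stepLaw hn hμ ν k
    have h2 := isFiniteMeasure_iterate_coupledStep hn hμ ν k
    rw [Function.iterate_succ_apply', Function.iterate_succ_apply',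
      stepLaw_eq hn hμ ((ae_iterate_stepLaw hn hμ h0 k).mono fun x hx => hx.1), h ν hν h0,
      coupledStep_add hn hμ, add_assoc]

theorem IsEquilibrium.iterate_stepLaw {ν : Measure ℝ} (h : IsEquilibrium n μ ν) (k : ℕ) :
    (stepLaw n μ)^[k] ν = ν :=
  Function.iterate_fixed (f := stepLaw n μ) h.2 k

/-- Both laws are fixed by `k` steps, hence share the common part and differ by remainders of mass
`q ^ k`, which tends to `0`. -/
theorem isEquilibrium_unique (hn : 1 ≤ n) (hμ : 0 < μ) {ν ν' : Measure ℝ}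
    (h : IsEquilibrium n μ ν) (h' : IsEquilibrium n μ ν') : ν = ν' := by
  have key : ∀ ν ν' : Measure ℝ, IsEquilibrium n μ ν → IsEquilibrium n μ ν' → ν ≤ ν' := by
    intro ν ν' h h'
    have hp := h.1
    refine Measure.le_iff.2 fun s _ => ?_
    have hle : ∀ k, ν s ≤ ν' s + couplingMass n μ ^ k := by
      intro k
      obtain ⟨κ, -, hk⟩ := exists_iterate_stepLaw_eq hn hμ k
      have e1 := hk ν h.1 (h.ae_mem_Icc hn hμ)
      have e2 := hk ν' h'.1 (h'.ae_mem_Icc hn hμ)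
      rw [h.iterate_stepLaw] at e1
      rw [h'.iterate_stepLaw] at e2
      have m1 := iterate_coupledStep_univ hn hμ ν k
      rw [measure_univ (μ := ν), mul_one] at m1
      calc ν s = κ s + (coupledStep n μ)^[k] ν s := by
            conv_lhs => rw [e1]
            rfl
        _ ≤ ν' s + couplingMass n μ ^ k := by
            refine add_le_add ?_ ((measure_mono (Set.subset_univ s)).trans_eq m1)
            rw [e2]
            exact Measure.le_add_right le_rfl s
    have ht : Tendsto (fun k => ν' s + couplingMass n μ ^ k) atTop (𝓝 (ν' s + 0)) :=
      (ENNReal.tendsto_pow_atTop_nhds_zero_of_lt_one (couplingMass_lt_one hn hμ)).const_add _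
    rw [add_zero] at ht
    exact ge_of_tendsto' ht hle
  exact le_antisymm (key _ _ h h') (key _ _ h' h)

/-- The affine equation `ν = resetLaw + coupledStep ν` is solved by its Neumann series, whose mass
is `∑ q ^ k (1 - q) = 1`. -/
theorem exists_isEquilibrium (hn : 1 ≤ n) (hμ : 0 < μ) : ∃ ν, IsEquilibrium n μ ν := by
  have hq := couplingMass_lt_one hn hμ
  have hreset : IsFiniteMeasure (resetLaw n μ) :=
    Measure.smul_finite _ (tsub_le_self.trans_lt ENNReal.one_lt_top).ne
  have hfin := isFiniteMeasure_iterate_coupledStep hn hμ (resetLaw n μ)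
  set ν : Measure ℝ := Measure.sum fun k => (coupledStep n μ)^[k] (resetLaw n μ) with hν
  have hprob : IsProbabilityMeasure ν := by
    refine ⟨?_⟩
    rw [hν, Measure.sum_apply _ MeasurableSet.univ]
    simp_rw [iterate_coupledStep_univ hn hμ]
    rw [ENNReal.tsum_mul_right, ENNReal.tsum_geometric]
    have : resetLaw n μ Set.univ = 1 - couplingMass n μ := by simp [resetLaw]
    rw [this]
    exact ENNReal.inv_mul_cancel (tsub_pos_of_lt hq).ne'
      (tsub_le_self.trans_lt ENNReal.one_lt_top).ne
  have h0 : ∀ᵐ x ∂ν, 0 ≤ x := by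
    rw [hν, Measure.ae_sum_iff]
    intro k
    cases k with
    | zero =>
      exact Measure.ae_smul_measure ((ae_dirac_iff measurableSet_Ici).2 le_rfl) _
    | succ k =>
      rw [Function.iterate_succ_apply', coupledStep,
        ae_map_iff measurable_stepMap.aemeasurable measurableSet_Ici]
      exact ae_of_all _ fun x => le_max_left _ _
  refine ⟨ν, hprob, ?_⟩
  change stepLaw n μ ν = ν
  rw [stepLaw_eq hn hμ h0, hν, coupledStep_sum hn hμ]
  ext s hs
  rw [Measure.add_apply, Measure.sum_apply _ hs, Measure.sum_apply _ hs]
  symm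
  rw [tsum_eq_zero_add' ENNReal.summable]
  simp only [Function.iterate_succ_apply', Function.iterate_zero_apply]

/-- The common part cancels. Each remainder has mass `q ^ k` and lives on `[0, 1]`, so its integral
lies in `[0, q ^ k]`. -/
theorem abs_integral_iterate_stepLaw_sub_le (hn : 1 ≤ n) (hμ : 0 < μ) {ν ν' : Measure ℝ}
    [hν : IsProbabilityMeasure ν] [hν' : IsProbabilityMeasure ν']
    (h : ∀ᵐ x ∂ν, x ∈ Set.Icc (0 : ℝ) 1) (h' : ∀ᵐ x ∂ν', x ∈ Set.Icc (0 : ℝ) 1) (k : ℕ) :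
    |∫ w, w ∂((stepLaw n μ)^[k] ν) - ∫ w, w ∂((stepLaw n μ)^[k] ν')| ≤
      (couplingMass n μ).toReal ^ k := by
  obtain ⟨κ, hκ, hk⟩ := exists_iterate_stepLaw_eq hn hμ k
  have main : ∀ ν : Measure ℝ, IsProbabilityMeasure ν → (∀ᵐ x ∂ν, x ∈ Set.Icc (0 : ℝ) 1) →
      ∃ a, ∫ w, w ∂((stepLaw n μ)^[k] ν) = (∫ w, w ∂κ) + a ∧ 0 ≤ a ∧
        a ≤ (couplingMass n μ).toReal ^ k := by
    intro ν hν h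
    have e := hk ν hν h
    have hf := isFiniteMeasure_iterate_coupledStep hn hμ ν k
    have hmem := ae_iterate_stepLaw hn hμ h k
    rw [e, ae_add_measure_iff] at hmem
    have hi : ∀ ρ : Measure ℝ, IsFiniteMeasure ρ → (∀ᵐ x ∂ρ, x ∈ Set.Icc (0 : ℝ) 1) →
        Integrable (fun w : ℝ => w) ρ := fun ρ _ h =>
      integrable_of_continuous_of_ae_mem_Icc h continuous_id
    refine ⟨∫ w, w ∂((coupledStep n μ)^[k] ν), ?_, ?_, ?_⟩
    · rw [e, integral_add_measure (hi _ hκ hmem.1) (hi _ hf hmem.2)]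
    · exact integral_nonneg_of_ae (hmem.2.mono fun x hx => hx.1)
    · calc ∫ w, w ∂((coupledStep n μ)^[k] ν) ≤ ∫ _, (1 : ℝ) ∂((coupledStep n μ)^[k] ν) :=
            integral_mono_ae (hi _ hf hmem.2) (integrable_const _)
              (hmem.2.mono fun x hx => hx.2)
        _ = (couplingMass n μ).toReal ^ k := by
            rw [integral_const, smul_eq_mul, mul_one, Measure.real,
              iterate_coupledStep_univ hn hμ, measure_univ, mul_one, ENNReal.toReal_pow]
  obtain ⟨a, ha, ha0, ha1⟩ := main ν hν h
  obtain ⟨b, hb, hb0, hb1⟩ := main ν' hν' h'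
  rw [ha, hb, abs_le]
  constructor <;> linarith

end

/-! ### Deterministic averaging and renewal lemmas. -/

theorem sum_range_mul_eq (z : ℕ → ℝ) (J m : ℕ) :
    ∑ k ∈ Finset.range (J * m), z k =
      ∑ i ∈ Finset.range m, ∑ j ∈ Finset.range J, z (j * m + i) := by
  rw [Finset.sum_comm]
  induction J with
  | zero => simp
  | succ J ih => rw [Nat.succ_mul, Finset.sum_range_add, ih, Finset.sum_range_succ]

/-- Averages of a sequence in `[0, 1]` converge as soon as those over long blocks are
arbitrarily close to the limit. -/
theorem tendsto_average_of_blocks {z : ℕ → ℝ} {v : ℝ} (hz : ∀ k, z k ∈ Set.Icc (0 : ℝ) 1)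
    (hv : v ∈ Set.Icc (0 : ℝ) 1)
    (h : ∀ ε : ℝ, 0 < ε → ∃ m : ℕ, 1 ≤ m ∧ ∀ᶠ J : ℕ in atTop,
      |∑ k ∈ Finset.range (J * m), z k - J * m * v| ≤ ε * (J * m)) :
    Tendsto (fun N : ℕ => (∑ k ∈ Finset.range N, z k) / N) atTop (𝓝 v) := by
  rw [Metric.tendsto_atTop]
  intro ε hε
  obtain ⟨m, hm, hJ⟩ := h (ε / 2) (by positivity)
  obtain ⟨J0, hJ0⟩ := eventually_atTop.1 hJ
  -- Beyond `N1` the incomplete last block, which costs at most `m`, is below `ε / 2 * N`.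
  obtain ⟨N1, hN1⟩ := exists_nat_gt (2 * m / ε)
  refine ⟨max (J0 * m) (N1 + 1), fun N hN => ?_⟩
  have hNJ : J0 * m ≤ N := (le_max_left _ _).trans hN
  have hNN : N1 + 1 ≤ N := (le_max_right _ _).trans hN
  have hNpos : (0 : ℝ) < N := by exact_mod_cast (Nat.succ_pos N1).trans_le hNN
  have hNbig : (m : ℝ) < ε / 2 * N := by
    have h1 : (N1 : ℝ) < N := by exact_mod_cast hNN
    rw [div_lt_iff₀ hε] at hN1
    nlinarith
  set J := N / m with hJdef
  have hJJ : J0 ≤ J := (Nat.le_div_iff_mul_le hm).2 hNJ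
  have hdecomp : N = J * m + N % m := by rw [hJdef, mul_comm]; exact (Nat.div_add_mod N m).symm
  have hmod : N % m < m := Nat.mod_lt _ hm
  have h1 := hJ0 J hJJ
  have h2 : |∑ i ∈ Finset.range (N % m), z (J * m + i) - (N % m : ℕ) * v| ≤ m := by
    have : ∑ i ∈ Finset.range (N % m), z (J * m + i) - (N % m : ℕ) * v =
        ∑ i ∈ Finset.range (N % m), (z (J * m + i) - v) := by simp
    rw [this]
    calc |∑ i ∈ Finset.range (N % m), (z (J * m + i) - v)|
        ≤ ∑ i ∈ Finset.range (N % m), |z (J * m + i) - v| := Finset.abs_sum_le_sum_abs _ _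
      _ ≤ ∑ i ∈ Finset.range (N % m), (1 : ℝ) := Finset.sum_le_sum fun i _ => by
          rw [abs_le]
          constructor <;> linarith [(hz (J * m + i)).1, (hz (J * m + i)).2, hv.1, hv.2]
      _ ≤ m := by simpa using hmod.le
  have h3 : ∑ k ∈ Finset.range N, z k - N * v =
      (∑ k ∈ Finset.range (J * m), z k - J * m * v) +
      (∑ i ∈ Finset.range (N % m), z (J * m + i) - (N % m : ℕ) * v) := by
    have hcast : (N : ℝ) = J * m + (N % m : ℕ) := by exact_mod_cast hdecomp
    have hsum : ∑ k ∈ Finset.range N, z k = ∑ k ∈ Finset.range (J * m), z k +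
        ∑ i ∈ Finset.range (N % m), z (J * m + i) := by
      rw [← Finset.sum_range_add, ← hdecomp]
    rw [hsum, hcast]
    ring
  have h4 : (J * m : ℝ) ≤ N := by
    have : J * m ≤ N := by omega
    exact_mod_cast this
  have h5 : |∑ k ∈ Finset.range N, z k - N * v| < ε * N := by
    rw [h3]
    calc _ ≤ _ := abs_add_le _ _
      _ ≤ ε / 2 * (J * m) + m := add_le_add h1 h2
      _ < ε * N := by nlinarith
  rw [Real.dist_eq]
  have h6 : (∑ k ∈ Finset.range N, z k) / N - v = (∑ k ∈ Finset.range N, z k - N * v) / N := by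
    field_simp
  rw [h6, abs_div, abs_of_pos hNpos, div_lt_iff₀ hNpos]
  exact h5

/-- If in every block of length `m` a sequence is coupled to one restarted at the beginning of
the block, and the restarted sequences obey the law of large numbers, then so does the original
one. -/
theorem tendsto_average_of_coupling {z : ℕ → ℝ} {v q : ℝ} {V D : ℕ → ℕ → ℝ} {a : ℕ → ℝ}
    (hz : ∀ k, z k ∈ Set.Icc (0 : ℝ) 1) (hv : v ∈ Set.Icc (0 : ℝ) 1) (hq0 : 0 ≤ q) (hq1 : q < 1)
    (hcoup : ∀ k i, |z (k + i) - V k i| ≤ D k i) (ha : ∀ i, |a i - v| ≤ q ^ i)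
    (hV : ∀ m i, i < m → Tendsto
      (fun J : ℕ => (∑ j ∈ Finset.range J, V (j * m) i) / J) atTop (𝓝 (a i)))
    (hD : ∀ m i, i < m → Tendsto
      (fun J : ℕ => (∑ j ∈ Finset.range J, D (j * m) i) / J) atTop (𝓝 (q ^ i))) :
    Tendsto (fun N : ℕ => (∑ k ∈ Finset.range N, z k) / N) atTop (𝓝 v) := by
  refine tendsto_average_of_blocks hz hv fun ε hε => ?_
  -- This bounds the total error of one block, `∑ 2 q ^ i`, uniformly in the block length; the `+ 1`
  -- makes the bound strict. A length `m > C / ε` then suffices.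
  set C : ℝ := 2 * (1 - q)⁻¹ + 1 with hC
  have hCpos : 0 < C := by
    have : 0 < 1 - q := by linarith
    positivity
  obtain ⟨m, hm⟩ := exists_nat_gt (C / ε)
  have hm0 : (0 : ℝ) < m := (by positivity : 0 < C / ε).trans hm
  refine ⟨m, by exact_mod_cast hm0, ?_⟩
  have hlim : Tendsto (fun J : ℕ => ∑ i ∈ Finset.range m,
      ((∑ j ∈ Finset.range J, D (j * m) i) / J + |(∑ j ∈ Finset.range J, V (j * m) i) / J - v|))
      atTop (𝓝 (∑ i ∈ Finset.range m, (q ^ i + |a i - v|))) := by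
    refine tendsto_finsetSum _ fun i hi => ?_
    rw [Finset.mem_range] at hi
    exact (hD m i hi).add ((hV m i hi).sub_const v).abs
  have hbound : ∑ i ∈ Finset.range m, (q ^ i + |a i - v|) < C := by
    have hgeom : ∑ i ∈ Finset.range m, q ^ i ≤ (1 - q)⁻¹ := by
      rw [← tsum_geometric_of_lt_one hq0 hq1]
      exact (summable_geometric_of_lt_one hq0 hq1).sum_le_tsum _ fun i _ => by positivity
    calc ∑ i ∈ Finset.range m, (q ^ i + |a i - v|) ≤ ∑ i ∈ Finset.range m, 2 * q ^ i :=
          Finset.sum_le_sum fun i _ => by linarith [ha i]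
      _ = 2 * ∑ i ∈ Finset.range m, q ^ i := by rw [Finset.mul_sum]
      _ < C := by linarith
  filter_upwards [hlim.eventually_lt_const hbound, eventually_gt_atTop 0] with J hJ hJpos
  have hJ0 : (0 : ℝ) < J := by exact_mod_cast hJpos
  have h1 : ∑ k ∈ Finset.range (J * m), z k - J * m * v =
      ∑ i ∈ Finset.range m, ∑ j ∈ Finset.range J, (z (j * m + i) - v) := by
    rw [sum_range_mul_eq]
    simp only [Finset.sum_sub_distrib, Finset.sum_const, Finset.card_range, nsmul_eq_mul]
    ring
  rw [h1]
  calc |∑ i ∈ Finset.range m, ∑ j ∈ Finset.range J, (z (j * m + i) - v)|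
      ≤ ∑ i ∈ Finset.range m, |∑ j ∈ Finset.range J, (z (j * m + i) - v)| :=
        Finset.abs_sum_le_sum_abs _ _
    _ ≤ ∑ i ∈ Finset.range m, J * ((∑ j ∈ Finset.range J, D (j * m) i) / J +
          |(∑ j ∈ Finset.range J, V (j * m) i) / J - v|) := by
        refine Finset.sum_le_sum fun i _ => ?_
        have e1 : ∑ j ∈ Finset.range J, (z (j * m + i) - v) =
            ∑ j ∈ Finset.range J, (z (j * m + i) - V (j * m) i) +
              J * ((∑ j ∈ Finset.range J, V (j * m) i) / J - v) := by
          simp only [Finset.sum_sub_distrib, Finset.sum_const, Finset.card_range, nsmul_eq_mul]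
          field_simp
          ring
        rw [e1, mul_add, mul_div_cancel₀ _ hJ0.ne']
        refine (abs_add_le _ _).trans (add_le_add ?_ ?_)
        · exact (Finset.abs_sum_le_sum_abs _ _).trans (Finset.sum_le_sum fun j _ => hcoup _ _)
        · rw [abs_mul, abs_of_pos hJ0]
    _ = J * ∑ i ∈ Finset.range m, ((∑ j ∈ Finset.range J, D (j * m) i) / J +
          |(∑ j ∈ Finset.range J, V (j * m) i) / J - v|) := by rw [Finset.mul_sum]
    _ ≤ J * C := by gcongr
    _ ≤ ε * (J * m) := by
        rw [div_lt_iff₀ hε] at hm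
        nlinarith

/-- The elementary renewal theorem for a deterministic sequence of epochs. -/
theorem tendsto_ncard_div {T : ℕ → ℝ} (hT : Monotone T) {c : ℝ} (hc : 0 < c)
    (h : Tendsto (fun k : ℕ => T k / k) atTop (𝓝 c)) :
    Tendsto (fun t : ℝ => (Set.ncard {k : ℕ | 1 ≤ k ∧ T k ≤ t} : ℝ) / t) atTop (𝓝 c⁻¹) := by
  have hTtop : Tendsto T atTop atTop := by
    have h1 : Tendsto (fun k : ℕ => T k / k * k) atTop atTop :=
      h.pos_mul_atTop hc tendsto_natCast_atTop_atTop
    refine h1.congr' ?_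
    filter_upwards [eventually_gt_atTop 0] with k hk
    have : (k : ℝ) ≠ 0 := by exact_mod_cast hk.ne'
    field_simp
  set N : ℝ → ℕ := fun t => Set.ncard {k : ℕ | 1 ≤ k ∧ T k ≤ t} with hN
  -- By monotonicity the counted indices form an initial segment of `1, 2, …`, so `N` inverts `T`
  -- and `T (N t) ≤ t < T (N t + 1)` once `N t ≥ 1`.
  have hiff : ∀ t k, 1 ≤ k → (T k ≤ t ↔ k ≤ N t) := by
    intro t
    have hex : ∃ M, t < T (M + 1) := by
      obtain ⟨M, hM⟩ := (hTtop.eventually_gt_atTop t).exists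
      exact ⟨M, hM.trans_le (hT (Nat.le_succ M))⟩
    classical
    have hset : {k : ℕ | 1 ≤ k ∧ T k ≤ t} = ↑(Finset.Icc 1 (Nat.find hex)) := by
      ext k
      simp only [Set.mem_ofPred_eq, Finset.coe_Icc, Set.mem_Icc, and_congr_right_iff]
      intro hk
      constructor
      · intro hkt
        by_contra! hlt
        exact absurd ((Nat.find_spec hex).trans_le (hT (Nat.succ_le_of_lt hlt))) hkt.not_gt
      · intro hle
        have := Nat.find_min hex (m := k - 1) (by omega)
        rw [Nat.sub_add_cancel hk] at this
        exact not_lt.1 this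
    have hNt : N t = Nat.find hex := by
      simp only [hN, hset, Set.ncard_coe_finset, Nat.card_Icc, Nat.add_sub_cancel]
    intro k hk
    have : k ∈ {k : ℕ | 1 ≤ k ∧ T k ≤ t} ↔ k ∈ (↑(Finset.Icc 1 (Nat.find hex)) : Set ℕ) := by
      rw [hset]
    simpa [hk, hNt] using this
  have hNtop : Tendsto N atTop atTop := by
    refine tendsto_atTop.2 fun b => ?_
    filter_upwards [eventually_ge_atTop (T (b + 1))] with t ht
    exact (Nat.le_succ b).trans ((hiff t (b + 1) (by omega)).1 ht)
  have hlow : Tendsto (fun t => T (N t) / N t) atTop (𝓝 c) := h.comp hNtop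
  have hup : Tendsto (fun t => T (N t + 1) / (N t + 1 : ℕ) * (1 + 1 / (N t : ℝ))) atTop
      (𝓝 (c * (1 + 0))) := by
    refine ((h.comp (tendsto_add_atTop_nat 1)).comp hNtop).mul (tendsto_const_nhds.add ?_)
    exact tendsto_one_div_atTop_nhds_zero_nat.comp hNtop
  rw [add_zero, mul_one] at hup
  have hmid : Tendsto (fun t => t / (N t : ℝ)) atTop (𝓝 c) := by
    refine tendsto_of_tendsto_of_tendsto_of_le_of_le' hlow hup ?_ ?_
    · filter_upwards [hNtop.eventually_ge_atTop 1] with t ht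
      have := (hiff t (N t) ht).2 le_rfl
      gcongr
    · filter_upwards [hNtop.eventually_ge_atTop 1] with t ht
      have h1 : t < T (N t + 1) := by
        by_contra! hle
        have := (hiff t (N t + 1) (by omega)).1 hle
        omega
      have h2 : (0 : ℝ) < N t := by exact_mod_cast ht
      have h3 : T (N t + 1) / (N t + 1 : ℕ) * (1 + 1 / (N t : ℝ)) = T (N t + 1) / N t := by
        push_cast
        field_simp
      rw [h3]
      gcongr
  refine (hmid.inv₀ hc.ne').congr fun t => ?_
  rw [inv_div]

/-! ### Restarted recursions and the strong law. -/

/-- The state reached from `x₀` in `i` steps of the recursion `x ↦ Ψ (R, P, x)` that is started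
when the item following the `k`-th order is about to be picked. -/
def restart {Ω E : Type*} (Ψ : ℝ × ℝ × E → E) (x₀ : E) (P R : ℕ → Ω → ℝ) (k : ℕ) :
    ℕ → Ω → E
  | 0, _ => x₀
  | i + 1, ω => Ψ (R (k + i + 2) ω, P (k + i + 1) ω, restart Ψ x₀ P R k i ω)

/-- The indices of the inputs used by `restart`. -/
def restartIndices (k i : ℕ) : Set (ℕ ⊕ ℕ) :=
  {x | Sum.elim (fun a => k ≤ a ∧ a < k + i) (fun b => k + 1 ≤ b ∧ b < k + i + 1) x}

/-- The σ-algebra generated by the inputs with index in `S`. -/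
abbrev inputSigma {Ω : Type*} (P R : ℕ → Ω → ℝ) (S : Set (ℕ ⊕ ℕ)) : MeasurableSpace Ω :=
  ⨆ s ∈ S, MeasurableSpace.comap
    (Sum.elim (fun k : ℕ => P (k + 1)) (fun k : ℕ => R (k + 1)) s) inferInstance

section

variable {Ω E : Type*} {P R : ℕ → Ω → ℝ}

theorem inputSigma_mono {S T : Set (ℕ ⊕ ℕ)} (h : S ⊆ T) : inputSigma P R S ≤ inputSigma P R T :=
  biSup_mono fun _ hs => h hs

theorem measurable_inputSigma_pick {S : Set (ℕ ⊕ ℕ)} {a : ℕ} (h : Sum.inl a ∈ S) :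
    Measurable[inputSigma P R S] (P (a + 1)) := by
  rw [measurable_iff_comap_le]
  exact le_biSup (fun s : ℕ ⊕ ℕ => MeasurableSpace.comap
    (Sum.elim (fun k : ℕ => P (k + 1)) (fun k : ℕ => R (k + 1)) s) inferInstance) h

theorem measurable_inputSigma_rotation {S : Set (ℕ ⊕ ℕ)} {b : ℕ} (h : Sum.inr b ∈ S) :
    Measurable[inputSigma P R S] (R (b + 1)) := by
  rw [measurable_iff_comap_le]
  exact le_biSup (fun s : ℕ ⊕ ℕ => MeasurableSpace.comap
    (Sum.elim (fun k : ℕ => P (k + 1)) (fun k : ℕ => R (k + 1)) s) inferInstance) h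

theorem measurable_inputSigma_restart [MeasurableSpace E] {Ψ : ℝ × ℝ × E → E} (hΨ : Measurable Ψ)
    (x₀ : E) (k i : ℕ) :
    Measurable[inputSigma P R (restartIndices k i)] (restart Ψ x₀ P R k i) := by
  induction i with
  | zero => exact @measurable_const _ _ _ (inputSigma P R (restartIndices k 0)) x₀
  | succ i ih =>
    have hsub : restartIndices k i ⊆ restartIndices k (i + 1) := by
      rintro (a | b) h
      · have h' : k ≤ a ∧ a < k + i := h
        exact (⟨h'.1, by omega⟩ : k ≤ a ∧ a < k + (i + 1))
      · have h' : k + 1 ≤ b ∧ b < k + i + 1 := h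
        exact (⟨h'.1, by omega⟩ : k + 1 ≤ b ∧ b < k + (i + 1) + 1)
    have h1 : Measurable[inputSigma P R (restartIndices k (i + 1))] (R (k + i + 2)) :=
      measurable_inputSigma_rotation (b := k + i + 1)
        (⟨by omega, by omega⟩ : k + 1 ≤ k + i + 1 ∧ k + i + 1 < k + (i + 1) + 1)
    have h2 : Measurable[inputSigma P R (restartIndices k (i + 1))] (P (k + i + 1)) :=
      measurable_inputSigma_pick (a := k + i)
        (⟨by omega, by omega⟩ : k ≤ k + i ∧ k + i < k + (i + 1))
    have h3 : Measurable[inputSigma P R (restartIndices k (i + 1))] (restart Ψ x₀ P R k i) :=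
      ih.mono (inputSigma_mono hsub) le_rfl
    exact hΨ.comp (h1.prodMk (h2.prodMk h3))

theorem restart_mem_Icc {Ψ : ℝ × ℝ × ℝ → ℝ} {x₀ : ℝ} (hx₀ : x₀ ∈ Set.Icc (0 : ℝ) 1)
    (ω : Ω) (hΨ : ∀ k, ∀ x ∈ Set.Icc (0 : ℝ) 1, Ψ (R (k + 2) ω, P (k + 1) ω, x) ∈ Set.Icc (0 : ℝ) 1)
    (k i : ℕ) : restart Ψ x₀ P R k i ω ∈ Set.Icc (0 : ℝ) 1 := by
  induction i with
  | zero => exact hx₀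
  | succ i ih => exact hΨ _ _ ih

variable [mΩ : MeasurableSpace Ω] {Pr : Measure Ω} {n : ℕ} {μ : ℝ}

theorem inputSigma_le (hP : ∀ k, Measurable (P k)) (hR : ∀ k, Measurable (R k))
    (S : Set (ℕ ⊕ ℕ)) : inputSigma P R S ≤ mΩ := by
  refine iSup₂_le fun s _ => ?_
  rw [← measurable_iff_comap_le]
  rcases s with a | b
  · exact hP _
  · exact hR _

theorem IsCarouselInput.indepFun {F G : Type*} [MeasurableSpace F] [MeasurableSpace G]
    (hP : ∀ k, Measurable (P k)) (hR : ∀ k, Measurable (R k))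
    (h : IsCarouselInput Pr n μ P R) {S T : Set (ℕ ⊕ ℕ)} (hST : Disjoint S T)
    {f : Ω → F} {g : Ω → G} (hf : Measurable[inputSigma P R S] f)
    (hg : Measurable[inputSigma P R T] g) : IndepFun f g Pr := by
  rw [IndepFun_iff_Indep]
  have hind := (iIndepFun_iff_iIndep _ _ _).1 h.indep
  have hle : ∀ s : ℕ ⊕ ℕ, MeasurableSpace.comap
      (Sum.elim (fun k : ℕ => P (k + 1)) (fun k : ℕ => R (k + 1)) s) inferInstance ≤ mΩ := by
    intro s
    rw [← measurable_iff_comap_le]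
    rcases s with a | b
    · exact hP _
    · exact hR _
  have hmain := indep_iSup_of_disjoint hle hind hST
  exact indep_of_indep_of_le_right
    (indep_of_indep_of_le_left hmain (measurable_iff_comap_le.1 hf)) (measurable_iff_comap_le.1 hg)

variable [IsProbabilityMeasure Pr]

theorem measurable_restart [MeasurableSpace E] (hP : ∀ k, Measurable (P k))
    (hR : ∀ k, Measurable (R k)) {Ψ : ℝ × ℝ × E → E} (hΨ : Measurable Ψ) (x₀ : E) (k i : ℕ) :
    Measurable (restart Ψ x₀ P R k i) :=
  (measurable_inputSigma_restart hΨ x₀ k i).mono (inputSigma_le hP hR _) le_rfl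

/-- The state after `i` steps depends only on inputs used before, so it is independent of the new
pair `(R, P)` and the joint law is a product. -/
theorem map_restart_succ [MeasurableSpace E] (hP : ∀ k, Measurable (P k)) (hR : ∀ k, Measurable (R k)) (h : IsCarouselInput Pr n μ P R)
    {Ψ : ℝ × ℝ × E → E} (hΨ : Measurable Ψ) (x₀ : E) (k i : ℕ) :
    Pr.map (restart Ψ x₀ P R k (i + 1)) =
      (rotationLaw.prod ((pickLaw n μ).prod (Pr.map (restart Ψ x₀ P R k i)))).map Ψ := by
  have hX := measurable_restart hP hR hΨ x₀ k i
  have hm := measurable_inputSigma_restart (P := P) (R := R) hΨ x₀ k i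
  have hind1 : IndepFun (P (k + i + 1)) (restart Ψ x₀ P R k i) Pr := by
    refine h.indepFun hP hR (S := {Sum.inl (k + i)}) (T := restartIndices k i) ?_
      (measurable_inputSigma_pick (Set.mem_singleton _)) hm
    rw [Set.disjoint_singleton_left]
    intro hmem
    have : k ≤ k + i ∧ k + i < k + i := hmem
    omega
  have hind2 : IndepFun (R (k + i + 2)) (fun ω => (P (k + i + 1) ω, restart Ψ x₀ P R k i ω)) Pr := by
    refine h.indepFun hP hR (S := {Sum.inr (k + i + 1)})
      (T := {Sum.inl (k + i)} ∪ restartIndices k i) ?_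
      (measurable_inputSigma_rotation (Set.mem_singleton _))
      ((measurable_inputSigma_pick (by simp)).prodMk
        (hm.mono (inputSigma_mono Set.subset_union_right) le_rfl))
    rw [Set.disjoint_singleton_left]
    rintro (hmem | hmem)
    · simp at hmem
    · have : k + 1 ≤ k + i + 1 ∧ k + i + 1 < k + i + 1 := hmem
      omega
  have e1 := (indepFun_iff_map_prod_eq_prod_map_map (hP _).aemeasurable hX.aemeasurable).1 hind1
  have e2 := (indepFun_iff_map_prod_eq_prod_map_map (hR _).aemeasurable
    ((hP _).prodMk hX).aemeasurable).1 hind2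
  rw [e1, (h.pick_law (k + i + 1) (by omega)).map_eq,
    (h.rotation_law (k + i + 2) (by omega)).map_eq] at e2
  rw [← e2, Measure.map_map hΨ ((hR _).prodMk ((hP _).prodMk hX))]
  rfl

/-- The restarted recursion has the same law whatever the time of its start. -/
theorem map_restart [MeasurableSpace E] (hP : ∀ k, Measurable (P k)) (hR : ∀ k, Measurable (R k)) (h : IsCarouselInput Pr n μ P R)
    {Ψ : ℝ × ℝ × E → E} (hΨ : Measurable Ψ) (x₀ : E) (k i : ℕ) :
    Pr.map (restart Ψ x₀ P R k i) =
      (fun ν : Measure E => (rotationLaw.prod ((pickLaw n μ).prod ν)).map Ψ)^[i]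
        (Measure.dirac x₀) := by
  induction i with
  | zero =>
    have : restart Ψ x₀ P R k 0 = fun _ => x₀ := rfl
    rw [this, Measure.map_const, measure_univ, one_smul]
    rfl
  | succ i ih => rw [map_restart_succ hP hR h hΨ, ih, Function.iterate_succ_apply']

/-- The strong law of large numbers for recursions restarted at the beginning of each block. -/
theorem tendsto_average_restart (hP : ∀ k, Measurable (P k)) (hR : ∀ k, Measurable (R k)) (h : IsCarouselInput Pr n μ P R)
    {Ψ : ℝ × ℝ × ℝ → ℝ} (hΨ : Measurable Ψ) (x₀ : ℝ)
    (hmem : ∀ k i, ∀ᵐ ω ∂Pr, restart Ψ x₀ P R k i ω ∈ Set.Icc (0 : ℝ) 1) {m i : ℕ} (hi : i < m) :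
    ∀ᵐ ω ∂Pr, Tendsto
      (fun J : ℕ => (∑ j ∈ Finset.range J, restart Ψ x₀ P R (j * m) i ω) / J) atTop
      (𝓝 (∫ x, x ∂((fun ν : Measure ℝ => (rotationLaw.prod ((pickLaw n μ).prod ν)).map Ψ)^[i]
        (Measure.dirac x₀)))) := by
  have hmeas := fun k => measurable_restart hP hR hΨ x₀ k i
  have hslln := strong_law_ae_real (μ := Pr) (fun j => restart Ψ x₀ P R (j * m) i) ?_ ?_ ?_
  · rw [← map_restart hP hR h hΨ x₀ (0 * m) i,
      integral_map (hmeas _).aemeasurable measurable_id'.aestronglyMeasurable]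
    exact hslln
  · refine Integrable.of_bound (hmeas _).aestronglyMeasurable 1 ?_
    filter_upwards [hmem (0 * m) i] with ω hω
    rw [Real.norm_eq_abs, abs_le]
    constructor <;> linarith [hω.1, hω.2]
  · intro j j' hjj
    refine h.indepFun hP hR ?_ (measurable_inputSigma_restart hΨ x₀ (j * m) i)
      (measurable_inputSigma_restart hΨ x₀ (j' * m) i)
    -- Distinct blocks start at least `m` apart and `i < m`, so their input windows are disjoint.
    -- Pairwise independence is all that `strong_law_ae_real` needs.
    have hsep : j * m + m ≤ j' * m ∨ j' * m + m ≤ j * m := by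
      rcases Nat.lt_or_gt_of_ne hjj with hlt | hlt
      · left
        rw [← Nat.succ_mul]
        exact Nat.mul_le_mul_right m hlt
      · right
        rw [← Nat.succ_mul]
        exact Nat.mul_le_mul_right m hlt
    rw [Set.disjoint_left]
    rintro (a | b) h1 h2
    · have h1' : j * m ≤ a ∧ a < j * m + i := h1
      have h2' : j' * m ≤ a ∧ a < j' * m + i := h2
      omega
    · have h1' : j * m + 1 ≤ b ∧ b < j * m + i + 1 := h1
      have h2' : j' * m + 1 ≤ b ∧ b < j' * m + i + 1 := h2
      omega
  · intro j
    exact ⟨(hmeas _).aemeasurable, (hmeas _).aemeasurable, by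
      rw [map_restart hP hR h hΨ, map_restart hP hR h hΨ]⟩

end

/-! ### Coupling of the waiting times and the throughput. -/

/-- The recursion for the indicator that no reset `R ≤ P` has happened yet. -/
noncomputable def survivalMap (x : ℝ × ℝ × ℝ) : ℝ := if x.2.1 < x.1 then x.2.2 else 0

theorem measurable_survivalMap : Measurable survivalMap :=
  Measurable.ite measurableSet_fst_snd_lt (by fun_prop) measurable_const

/-- The event `P < R` is independent of the current state, so each step multiplies the mean by `q`;
iterated, this gives survival probability `q ^ i`. -/
theorem integral_map_survivalMap {n : ℕ} {μ : ℝ} (hn : 1 ≤ n) (hμ : 0 < μ) (ν : Measure ℝ)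
    [IsProbabilityMeasure ν] (hν : Integrable (fun x : ℝ => x) ν) :
    ∫ x, x ∂((rotationLaw.prod ((pickLaw n μ).prod ν)).map survivalMap) =
      (couplingMass n μ).toReal * ∫ x, x ∂ν := by
  have hpick := isProbabilityMeasure_pickLaw hn hμ
  have hset : MeasurableSet {x : ℝ × ℝ | x.2 < x.1} := measurableSet_lt measurable_snd measurable_fst
  have hmass : (couplingMass n μ).toReal =
      ∫ r, ∫ p, {x : ℝ × ℝ | x.2 < x.1}.indicator (fun _ => (1 : ℝ)) (r, p) ∂(pickLaw n μ)
        ∂rotationLaw := by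
    rw [← integral_prod _ ((integrable_const (1 : ℝ)).indicator hset)]
    exact (integral_indicator_one hset).symm
  have hint : Integrable survivalMap (rotationLaw.prod ((pickLaw n μ).prod ν)) := by
    have h1 : Integrable (fun x : ℝ × ℝ × ℝ => x.2.2) (rotationLaw.prod ((pickLaw n μ).prod ν)) :=
      (hν.comp_snd (pickLaw n μ)).comp_snd rotationLaw
    exact h1.indicator measurableSet_fst_snd_lt
  rw [integral_map measurable_survivalMap.aemeasurable measurable_id'.aestronglyMeasurable,
    integral_prod _ hint, hmass, ← integral_mul_const]
  refine integral_congr_ae (ae_of_all _ fun r => ?_)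
  simp only
  rw [← integral_prod_mul]
  refine integral_congr_ae (ae_of_all _ fun y => ?_)
  simp only [survivalMap, Set.indicator_apply, Set.mem_ofPred_eq]
  split_ifs <;> simp

section

variable {Ω : Type*} {P R : ℕ → Ω → ℝ}

theorem waitingTime_nonneg (P R : ℕ → Ω → ℝ) (k : ℕ) (ω : Ω) : 0 ≤ waitingTime P R k ω := by
  cases k with
  | zero => exact le_rfl
  | succ k => exact le_max_left _ _

theorem waitingTime_le_one {ω : Ω} (hP : ∀ k, 0 ≤ P k ω) (hR : ∀ k, R (k + 1) ω < 1) (k : ℕ) :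
    waitingTime P R k ω ≤ 1 := by
  cases k with
  | zero => exact zero_le_one
  | succ k =>
    exact max_le zero_le_one (by linarith [hP k, hR k, waitingTime_nonneg P R k ω])

theorem stepMap_mem_Icc {ω : Ω} (hP : ∀ k, 0 ≤ P k ω) (hR : ∀ k, R (k + 1) ω < 1) (k : ℕ)
    (x : ℝ) (hx : x ∈ Set.Icc (0 : ℝ) 1) :
    stepMap (R (k + 2) ω, P (k + 1) ω, x) ∈ Set.Icc (0 : ℝ) 1 :=
  ⟨le_max_left _ _, max_le zero_le_one (by
    simp only
    linarith [hP (k + 1), hR (k + 1), hx.1])⟩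

theorem survivalMap_mem_Icc (r p : ℝ) {x : ℝ} (hx : x ∈ Set.Icc (0 : ℝ) 1) :
    survivalMap (r, p, x) ∈ Set.Icc (0 : ℝ) 1 := by
  unfold survivalMap
  split_ifs
  · exact hx
  · simp

/-- The step is 1-Lipschitz in the waiting time, and a reset sends both chains to `0`. The initial
gap of at most `1` thus never grows and disappears at the first reset. The comparison begins at
`W_{k+1}`, because the step from `W_0` uses `P_0 = 0`, which is not Erlang. -/
theorem abs_waitingTime_sub_restart_le {ω : Ω} (hP : ∀ k, 0 ≤ P k ω)
    (hR : ∀ k, R (k + 1) ω < 1) (k i : ℕ) :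
    |waitingTime P R (k + i + 1) ω - restart stepMap 0 P R k i ω| ≤
      restart survivalMap 1 P R k i ω := by
  induction i with
  | zero =>
    change |waitingTime P R (k + 1) ω - 0| ≤ 1
    rw [sub_zero, abs_of_nonneg (waitingTime_nonneg _ _ _ _)]
    exact waitingTime_le_one hP hR _
  | succ i ih =>
    have hW := waitingTime_nonneg P R (k + i + 1) ω
    have hV := (restart_mem_Icc (P := P) (R := R) (Ψ := stepMap) (x₀ := 0) (by simp) ω
      (stepMap_mem_Icc hP hR) k i).1
    change |max 0 (R (k + i + 2) ω - P (k + i + 1) ω - waitingTime P R (k + i + 1) ω) -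
        max 0 (R (k + i + 2) ω - P (k + i + 1) ω - restart stepMap 0 P R k i ω)| ≤
      survivalMap (R (k + i + 2) ω, P (k + i + 1) ω, restart survivalMap 1 P R k i ω)
    by_cases hlt : P (k + i + 1) ω < R (k + i + 2) ω
    · rw [survivalMap, if_pos hlt]
      rw [max_comm 0, max_comm 0]
      refine (abs_max_sub_max_le_abs _ _ _).trans (le_of_eq_of_le ?_ ih)
      rw [sub_sub_sub_cancel_left, abs_sub_comm]
    · rw [survivalMap, if_neg hlt, max_eq_left (by linarith), max_eq_left (by linarith), sub_zero,
        abs_zero]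

theorem completionTime_eq (k : ℕ) (ω : Ω) :
    completionTime P R k ω = ∑ j ∈ Finset.range k, waitingTime P R (j + 1) ω +
      ∑ j ∈ Finset.range k, P (j + 1) ω := by
  induction k with
  | zero => simp [completionTime]
  | succ k ih =>
    rw [completionTime, Finset.sum_Icc_succ_top (by omega), ← completionTime, ih,
      Finset.sum_range_succ, Finset.sum_range_succ]
    ring

theorem monotone_completionTime {ω : Ω} (hP : ∀ k, 0 ≤ P k ω) :
    Monotone fun k => completionTime P R k ω := by
  refine monotone_nat_of_le_succ fun k => ?_
  rw [completionTime, completionTime, Finset.sum_Icc_succ_top (by omega)]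
  linarith [hP (k + 1), waitingTime_nonneg P R (k + 1) ω]

variable [MeasurableSpace Ω] {Pr : Measure Ω} {n : ℕ} {μ : ℝ}

theorem IsCarouselInput.ae_bounds (h : IsCarouselInput Pr n μ P R) :
    ∀ᵐ ω ∂Pr, (∀ k, 0 ≤ P k ω) ∧ ∀ k, R (k + 1) ω < 1 := by
  rw [eventually_and, ae_all_iff, ae_all_iff]
  constructor
  · intro k
    rcases Nat.eq_zero_or_pos k with rfl | hk
    · exact ae_of_all _ fun ω => (h.pick_zero ω).ge
    · have hl := h.pick_law k hk
      refine ae_of_ae_map hl.aemeasurable (p := fun x => 0 ≤ x) ?_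
      rw [hl.map_eq]
      exact (ae_pos_pickLaw n μ).mono fun x hx => hx.le
  · intro k
    have hl := h.rotation_law (k + 1) (by omega)
    refine ae_of_ae_map hl.aemeasurable (p := fun x => x < 1) ?_
    rw [hl.map_eq]
    filter_upwards [ae_restrict_mem measurableSet_Ico] with r hr using hr.2

theorem IsCarouselInput.tendsto_average_pick (hn : 1 ≤ n) (hμ : 0 < μ)
    (h : IsCarouselInput Pr n μ P R) :
    ∀ᵐ ω ∂Pr, Tendsto (fun N : ℕ => (∑ k ∈ Finset.range N, P (k + 1) ω) / N) atTop
      (𝓝 (∫ p, p ∂(pickLaw n μ))) := by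
  have hl := fun k => h.pick_law (k + 1) (by omega)
  have hmap := (hl 0).map_eq
  have hs := strong_law_ae_real (μ := Pr) (fun k => P (k + 1)) ?_ ?_ ?_
  · rw [← hmap, integral_map (hl 0).aemeasurable measurable_id'.aestronglyMeasurable]
    exact hs
  · have hi := integrable_id_pickLaw hn hμ
    rw [← hmap, integrable_map_measure measurable_id'.aestronglyMeasurable (hl 0).aemeasurable]
      at hi
    exact hi
  · intro i j hij
    exact h.indep.indepFun (i := Sum.inl i) (j := Sum.inl j) (by simpa using hij)
  · intro k
    exact ⟨(hl k).aemeasurable, (hl 0).aemeasurable, by rw [(hl k).map_eq, (hl 0).map_eq]⟩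

variable [IsProbabilityMeasure Pr]

theorem integral_map_restart_survivalMap (hn : 1 ≤ n) (hμ : 0 < μ) (hP : ∀ k, Measurable (P k))
    (hR : ∀ k, Measurable (R k)) (h : IsCarouselInput Pr n μ P R) (k i : ℕ) :
    ∫ x, x ∂(Pr.map (restart survivalMap 1 P R k i)) = (couplingMass n μ).toReal ^ i := by
  have hmeas := measurable_restart hP hR measurable_survivalMap 1 k
  induction i with
  | zero =>
    have : restart survivalMap 1 P R k 0 = fun _ => (1 : ℝ) := rfl
    rw [this, Measure.map_const, measure_univ, one_smul, integral_dirac, pow_zero]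
  | succ i ih =>
    have hprob := Measure.isProbabilityMeasure_map (μ := Pr) (hmeas i).aemeasurable
    have hint : Integrable (fun x : ℝ => x) (Pr.map (restart survivalMap 1 P R k i)) := by
      refine integrable_of_continuous_of_ae_mem_Icc ?_ continuous_id
      rw [ae_map_iff (hmeas i).aemeasurable (p := fun x => x ∈ Set.Icc (0 : ℝ) 1) measurableSet_Icc]
      exact ae_of_all _ fun ω => restart_mem_Icc (by simp) ω
        (fun _ _ hx => survivalMap_mem_Icc _ _ hx) k i
    rw [map_restart_succ hP hR h measurable_survivalMap, integral_map_survivalMap hn hμ _ hint, ih,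
      pow_succ']

/-- The pathwise lemma `tendsto_average_of_coupling` applies with copies restarted from `0` as `V`
and survival indicators as `D`. Only countably many pairs `(m, i)` occur, so a single null set is
discarded. -/
theorem tendsto_average_waitingTime (hn : 1 ≤ n) (hμ : 0 < μ) (hP : ∀ k, Measurable (P k))
    (hR : ∀ k, Measurable (R k)) (h : IsCarouselInput Pr n μ P R) {ν : Measure ℝ}
    (hν : IsEquilibrium n μ ν) :
    ∀ᵐ ω ∂Pr, Tendsto (fun N : ℕ => (∑ k ∈ Finset.range N, waitingTime P R (k + 1) ω) / N) atTop
      (𝓝 (∫ w, w ∂ν)) := by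
  have hprob := hν.1
  have hq := couplingMass_lt_one hn hμ
  have hmem := hν.ae_mem_Icc hn hμ
  have hint : Integrable (fun w : ℝ => w) ν :=
    integrable_of_continuous_of_ae_mem_Icc hmem continuous_id
  have hmean : ∫ w, w ∂ν ∈ Set.Icc (0 : ℝ) 1 := by
    constructor
    · exact integral_nonneg_of_ae (hmem.mono fun x hx => hx.1)
    · calc ∫ w, w ∂ν ≤ ∫ _, (1 : ℝ) ∂ν :=
            integral_mono_ae hint (integrable_const _) (hmem.mono fun x hx => hx.2)
        _ = 1 := by simp
  have hV : ∀ᵐ ω ∂Pr, ∀ m i, i < m → Tendsto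
      (fun J : ℕ => (∑ j ∈ Finset.range J, restart stepMap 0 P R (j * m) i ω) / J) atTop
      (𝓝 (∫ w, w ∂((stepLaw n μ)^[i] (Measure.dirac 0)))) := by
    refine ae_all_iff.2 fun m => ae_all_iff.2 fun i => ?_
    by_cases hi : i < m
    · refine (tendsto_average_restart hP hR h measurable_stepMap 0 (fun k i => ?_) hi).mono
        fun ω hω _ => hω
      filter_upwards [h.ae_bounds] with ω hω
      exact restart_mem_Icc (by simp) ω (stepMap_mem_Icc hω.1 hω.2) k i
    · exact ae_of_all _ fun ω hi' => absurd hi' hi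
  have hD : ∀ᵐ ω ∂Pr, ∀ m i, i < m → Tendsto
      (fun J : ℕ => (∑ j ∈ Finset.range J, restart survivalMap 1 P R (j * m) i ω) / J) atTop
      (𝓝 ((couplingMass n μ).toReal ^ i)) := by
    refine ae_all_iff.2 fun m => ae_all_iff.2 fun i => ?_
    by_cases hi : i < m
    · rw [← integral_map_restart_survivalMap hn hμ hP hR h 0 i,
        map_restart hP hR h measurable_survivalMap]
      refine (tendsto_average_restart hP hR h measurable_survivalMap 1 (fun k i => ?_) hi).mono
        fun ω hω _ => hω
      exact ae_of_all _ fun ω => restart_mem_Icc (by simp) ω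
        (fun _ _ hx => survivalMap_mem_Icc _ _ hx) k i
    · exact ae_of_all _ fun ω hi' => absurd hi' hi
  filter_upwards [h.ae_bounds, hV, hD] with ω hω hVω hDω
  refine tendsto_average_of_coupling
    (fun k => ⟨waitingTime_nonneg _ _ _ _, waitingTime_le_one hω.1 hω.2 _⟩) hmean
    ENNReal.toReal_nonneg ?_ (abs_waitingTime_sub_restart_le hω.1 hω.2) (fun i => ?_) hVω hDω
  · have := (ENNReal.toReal_lt_toReal (hq.trans ENNReal.one_lt_top).ne ENNReal.one_ne_top).2 hq
    simpa using this
  · have h0 : ∀ᵐ x ∂(Measure.dirac (0 : ℝ)), x ∈ Set.Icc (0 : ℝ) 1 :=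
      (ae_dirac_iff measurableSet_Icc).2 (by simp)
    have := abs_integral_iterate_stepLaw_sub_le hn hμ h0 hmem i
    rwa [hν.iterate_stepLaw] at this

theorem isThroughput_of_measurable (hn : 1 ≤ n) (hμ : 0 < μ) (hP : ∀ k, Measurable (P k))
    (hR : ∀ k, Measurable (R k)) (h : IsCarouselInput Pr n μ P R) {ν : Measure ℝ}
    (hν : IsEquilibrium n μ ν) :
    IsThroughput Pr P R ((∫ p, p ∂(pickLaw n μ)) + ∫ w, w ∂ν)⁻¹ := by
  have hpos : 0 < (∫ p, p ∂(pickLaw n μ)) + ∫ w, w ∂ν := by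
    rw [integral_id_pickLaw hn hμ]
    have h1 : (0 : ℝ) < n := by exact_mod_cast hn
    have h2 : 0 ≤ ∫ w, w ∂ν :=
      integral_nonneg_of_ae ((hν.ae_mem_Icc hn hμ).mono fun x hx => hx.1)
    positivity
  filter_upwards [h.ae_bounds, h.tendsto_average_pick hn hμ,
    tendsto_average_waitingTime hn hμ hP hR h hν] with ω hω hpick hwait
  refine tendsto_ncard_div (monotone_completionTime hω.1) hpos ?_
  refine (hpick.add hwait).congr fun k => ?_
  rw [completionTime_eq, ← add_div, add_comm]

/-- `HasLaw` provides only a.e. measurability. The inputs are replaced by measurable versions, and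
off one null set every completion time is unchanged. -/
theorem isThroughput (hn : 1 ≤ n) (hμ : 0 < μ) (h : IsCarouselInput Pr n μ P R) {ν : Measure ℝ}
    (hν : IsEquilibrium n μ ν) :
    IsThroughput Pr P R ((∫ p, p ∂(pickLaw n μ)) + ∫ w, w ∂ν)⁻¹ := by
  have hPae : ∀ k, ∃ g, Measurable g ∧ P (k + 1) =ᵐ[Pr] g := fun k =>
    (h.pick_law (k + 1) (by omega)).aemeasurable
  have hRae : ∀ k, ∃ g, Measurable g ∧ R (k + 1) =ᵐ[Pr] g := fun k =>
    (h.rotation_law (k + 1) (by omega)).aemeasurable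
  choose gP hgP hPg using hPae
  choose gR hgR hRg using hRae
  set P' : ℕ → Ω → ℝ := fun k => Nat.casesOn k (fun _ => 0) gP with hP'
  -- The value at index `0` is arbitrary, since the recursion only reads `R (k + 1)`.
  set R' : ℕ → Ω → ℝ := fun k => Nat.casesOn k (fun _ => 0) gR with hR'
  have hPm : ∀ k, Measurable (P' k) := by
    rintro (_ | k)
    · exact measurable_const
    · exact hgP k
  have hRm : ∀ k, Measurable (R' k) := by
    rintro (_ | k)
    · exact measurable_const
    · exact hgR k
  have h' : IsCarouselInput Pr n μ P' R' := by
    refine ⟨fun ω => rfl, ?_, ?_, ?_⟩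
    · rintro (_ | k) hk
      · omega
      · exact (h.pick_law (k + 1) hk).congr (hPg k).symm
    · rintro (_ | k) hk
      · omega
      · exact (h.rotation_law (k + 1) hk).congr (hRg k).symm
    · refine h.indep.congr ?_
      rintro (k | k)
      · exact hPg k
      · exact hRg k
  filter_upwards [isThroughput_of_measurable hn hμ hPm hRm h' hν, ae_all_iff.2 hPg,
    ae_all_iff.2 hRg] with ω hω hPω hRω
  have hPeq : ∀ k, P k ω = P' k ω := by
    rintro (_ | k)
    · exact h.pick_zero ω
    · exact hPω k
  have hWeq : ∀ k, waitingTime P R k ω = waitingTime P' R' k ω := by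
    intro k
    induction k with
    | zero => rfl
    | succ k ih =>
      change max 0 (R (k + 1) ω - P k ω - waitingTime P R k ω) =
        max 0 (R' (k + 1) ω - P' k ω - waitingTime P' R' k ω)
      rw [ih, hPeq, hRω]
  have hTeq : ∀ k, completionTime P R k ω = completionTime P' R' k ω := fun k =>
    Finset.sum_congr rfl fun j _ => by rw [hWeq, hPeq]
  refine hω.congr fun t => ?_
  simp only [ordersProcessed, hTeq]

end

end Carousel

/-- The parameter `r` lists the zeros of `R`, counted with multiplicity. -/
theorem mainTheorem2 (n : ℕ) (hn : 1 ≤ n) (μ : ℝ) (hμ : 0 < μ)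
    {Ω : Type*} [MeasurableSpace Ω] (Pr : Measure Ω) [IsProbabilityMeasure Pr]
    (P R : ℕ → Ω → ℝ) (hPR : Carousel.IsCarouselInput Pr n μ P R)
    (r : Fin (2 * n + 2) → ℂ)
    (hr : (Carousel.polyR n μ).roots = Finset.univ.val.map r) :
    (∀ i, r i ≠ 0 ∧ (derivative (Carousel.polyR n μ)).eval (r i) ≠ 0) ∧
    ∃ (ν : Measure ℝ) (τ : ℝ),
      (Carousel.IsEquilibrium n μ ν ∧ ∀ ν', Carousel.IsEquilibrium n μ ν' → ν' = ν) ∧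
      ν.restrict (Set.Ioc 0 1) ≪ volume ∧
      Carousel.IsThroughput Pr P R τ ∧
      Integrable (fun p : ℝ => p) (Carousel.pickLaw n μ) ∧ Integrable (fun w : ℝ => w) ν ∧
      τ⁻¹ = (∫ p, p ∂(Carousel.pickLaw n μ)) + ∫ w, w ∂ν ∧
      ((τ⁻¹ : ℝ) : ℂ) = (n : ℂ) / (μ : ℂ) +
        ∑ i, Carousel.coeffC n μ ν (r i) / (r i) ^ 2 *
          (1 + (r i - 1) * Complex.exp (r i)) := by
  have hroot : ∀ i, (Carousel.polyR n μ).eval (r i) = 0 := by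
    intro i
    have : r i ∈ (Carousel.polyR n μ).roots := by
      rw [hr, Multiset.mem_map]
      exact ⟨i, Finset.mem_univ i, rfl⟩
    exact (mem_roots (Carousel.polyR_ne_zero hμ)).1 this
  have hr0 : ∀ i, r i ≠ 0 := by
    intro i hi
    have := hroot i
    rw [hi] at this
    exact Carousel.polyR_eval_zero_ne hμ this
  obtain ⟨ν, hν⟩ := Carousel.exists_isEquilibrium hn hμ
  have hprob := hν.1
  refine ⟨fun i => ⟨hr0 i, Carousel.polyR_simple_root hn hμ (hroot i)⟩, ν,
    ((∫ p, p ∂(Carousel.pickLaw n μ)) + ∫ w, w ∂ν)⁻¹,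
    ⟨hν, fun ν' hν' => Carousel.isEquilibrium_unique hn hμ hν' hν⟩,
    hν.absolutelyContinuous hn hμ, Carousel.isThroughput hn hμ hPR hν,
    Carousel.integrable_id_pickLaw hn hμ,
    Carousel.integrable_of_continuous_of_ae_mem_Icc (hν.ae_mem_Icc hn hμ) continuous_id,
    inv_inv _, ?_⟩
  rw [inv_inv, Complex.ofReal_add, Carousel.integral_id_equilibrium hn hμ hν hr hr0,
    Carousel.integral_id_pickLaw hn hμ]
  push_cast
  rfl
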